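/- **Conventions.** A category $\mathbb C$ *has local products* if for all $f\colon A\to B$, $r\colon B\to A$, $g\colon C\to B$, $s\colon B\to C$ with $fr=1_B=gs$ the pullback $A\xleftarrow{\pi_1}A\times_BC\xrightarrow{\pi_2}C$ of $g$ along $f$ exists. Let $\mathbb C$ be such a category, with a fixed choice of the pullbacks used below. A *local product* is a diagram $p_1\colon E\to A$, $e_1\colon A\to E$, $p_2\colon E\to C$, $e_2\colon C\to E$ for which there are $f,r,g,s$ as above such that $(E,p_1,p_2)$ is a pullback of $g$ along $f$, $e_1=\langle 1_A,sf\rangle$ and $e_2=\langle rg,1_C\rangle$; its *span part* is $(E,p_1,p_2)$. *Spans.* A span $(D,d,c)$ is a pair $d\colon D\to D_0$, $c\colon D\to D_1$ whose legs both have kernel pairs $d_1,d_2\colon D(d)\to D$ and $c_1,c_2\colon D(c)\to D$; a morphism of spans is a triple $(h,h_0,h_1)$ commuting with the legs. The *kernel pair construction* forms the pullback $D(d,c)$ of $c_1$ along $d_2$, with projections $p_1,p_2$ (the generalized triples $(x,y,z)$ with $dx=dy$, $cy=cz$), and the morphisms $\mathrm{dom}=d_1p_1$, $\mathrm{cod}=c_2p_2$,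 $e_1\colon(x,y)\mapsto(x,y,y)$, $e_2\colon(y,z)\mapsto(y,y,z)$. A class $\mathcal M$ of spans is *closed under the kernel pair construction* if $(D,d,c)\in\mathcal M$ implies $(D(d,c),\mathrm{dom},\mathrm{cod})\in\mathcal M$. *Structures.* (a) A reflexive graph is $(C_1,C_0,d,e,c)$ with $d,c\colon C_1\to C_0$, $e\colon C_0\to C_1$, $de=1=ce$; its span part is $(C_1,d,c)$; morphisms are pairs $(f_1,f_0)$ commuting with $d,e,c$. (b) A unital multiplicative graph is a reflexive graph with $m\colon C_2\to C_1$, where $C_2=C_1\times_{C_0}C_1$ is the pullback of $c$ along $d$ with projections $\pi_1,\pi_2$ ($d\pi_1=c\pi_2$), such that $dm=d\pi_2$, $cm=c\pi_1$, $m\langle 1,ed\rangle=1=m\langle ec,1\rangle$; morphisms are graph morphisms with $f_1m=m'(f_1\times_{f_0}f_1)$. It is an internal category if $m$ is associative, and an internal groupoid if moreover there is an inversion $i\colon C_1\to C_1$ with $di=c$, $ci=d$, $m\langle 1,i\rangle=ec$, $m\langle i,1\rangle=ed$; the morphisms are the same. (c) A pregroupoid is a span with $p\colon D(d,c)\to D$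 such that $pe_1=d_1$, $pe_2=c_2$, $dp=dc_2p_2$, $cp=cd_1p_1$; morphisms are span morphisms compatible with $p$. (d) A directed kite consists of $f,r,g,s$ with $fr=1_B=gs$, a span $(D,d,c)$, and $\alpha\colon A\to D$, $\beta\colon B\to D$, $\gamma\colon C\to D$ with $\alpha r=\beta=\gamma s$, $d\alpha=d\beta f$, $c\gamma=c\beta g$; morphisms are natural transformations of such diagrams. It is multiplicative if equipped with $m\colon A\times_BC\to D$ such that $dm=d\gamma\pi_2$, $cm=c\alpha\pi_1$, $m\langle 1_A,sf\rangle=\alpha$, $m\langle rg,1_C\rangle=\gamma$; morphisms of multiplicative directed kites are also compatible with $m$. For a class $\mathcal M$ of spans, $\mathbf{RG}(\mathbb C,\mathcal M)$, $\mathbf{UMG}(\mathbb C,\mathcal M)$, $\mathbf{Cat}(\mathbb C,\mathcal M)$, $\mathbf{Grpd}(\mathbb C,\mathcal M)$, $\mathbf{Span}(\mathbb C,\mathcal M)$, $\mathbf{PreGrpd}(\mathbb C,\mathcal M)$, $\mathbf{DiKite}(\mathbb C,\mathcal M)$, $\mathbf{MKite}(\mathbb C,\mathcal M)$ denote the full subcategories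 of the categories of reflexive graphs, unital multiplicative graphs, internal categories, internal groupoids, spans, pregroupoids, directed kites and multiplicative directed kites on the objects whose span $(C_1,d,c)$, respectively $(D,d,c)$, is in $\mathcal M$. Isomorphism means isomorphism of categories; a section of a functor $F$ is a functor $G$ with $FG=1$. **Theorem (Unification Theorem).** Let $\mathbb C$ be a category with local products, and let $\mathcal M$ be a class of spans in $\mathbb C$ that is closed under the kernel pair construction and contains the span part of every local product. Then the following conditions are equivalent: 1. the forgetful functor $\mathbf{Grpd}(\mathbb C,\mathcal M)\to\mathbf{RG}(\mathbb C,\mathcal M)$ is an isomorphism; 2. the forgetful functor $\mathbf{Grpd}(\mathbb C,\mathcal M)\to\mathbf{RG}(\mathbb C,\mathcal M)$ has a section; 3. the forgetful functor $\mathbf{Cat}(\mathbb C,\mathcal M)\to\mathbf{RG}(\mathbb C,\mathcal M)$ is an isomorphism; 4. the forgetful functor $\mathbf{Cat}(\mathbb C,\mathcal M)\to\mathbf{RG}(\mathbb C,\mathcal M)$ has a section; 5. the forgetful functor $\mathbf{UMG}(\mathbb C,\mathcal M)\to\mathbf{RG}(\mathbb C,\mathcal M)$ is an isomorphism; 6.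 the forgetful functor $\mathbf{UMG}(\mathbb C,\mathcal M)\to\mathbf{RG}(\mathbb C,\mathcal M)$ has a section; 7. the forgetful functor $\mathbf{PreGrpd}(\mathbb C,\mathcal M)\to\mathbf{Span}(\mathbb C,\mathcal M)$ is an isomorphism; 8. the forgetful functor $\mathbf{PreGrpd}(\mathbb C,\mathcal M)\to\mathbf{Span}(\mathbb C,\mathcal M)$ has a section; 9. the forgetful functor $\mathbf{MKite}(\mathbb C,\mathcal M)\to\mathbf{DiKite}(\mathbb C,\mathcal M)$ is an isomorphism; 10. the forgetful functor $\mathbf{MKite}(\mathbb C,\mathcal M)\to\mathbf{DiKite}(\mathbb C,\mathcal M)$ has a section; 11. (Kite Condition) for all spans $(D,d,c)$ and $(E,p_1\colon E\to A,p_2\colon E\to C)$ in $\mathcal M$ with $(p_1,p_2)$ jointly monic, and all morphisms $e_1\colon A\to E$, $e_2\colon C\to E$, $\alpha\colon A\to D$, $\beta\colon E\to D$, $\gamma\colon C\to D$ such that $$p_1e_1=1_A,\quad p_2e_2=1_C,\quad (e_1p_1)(e_2p_2)=(e_2p_2)(e_1p_1),\quad \alpha(p_1e_2p_2)=\beta=\gamma(p_2e_1p_1),$$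 $$d\alpha p_1=d\alpha(p_1e_2p_2),\quad c\gamma p_2=c\gamma(p_2e_1p_1),$$ there is a unique morphism $m\colon E\to D$ with $me_1=\alpha$, $me_2=\gamma$, $dm=d\gamma p_2$ and $cm=c\alpha p_1$. -/

import Mathlib

open CategoryTheory CategoryTheory.Limits

universe v u

namespace RelMaltsev

/-! Composition is written in diagrammatic order: `f ≫ g` is the composite usually written `g f`. -/

/-! ### Local products -/

/-- A category has local products when pullbacks of split epimorphisms along split epimorphisms
exist. The canonical local product of `f` and `g` is Mathlib's chosen `pullback f g`. -/
class HasLocalProducts (C : Type u) [Category.{v} C] : Prop where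
  hasPullback : ∀ {A B C' : C} (f : A ⟶ B) (r : B ⟶ A) (g : C' ⟶ B) (s : B ⟶ C'),
    r ≫ f = 𝟙 B → s ≫ g = 𝟙 B → HasPullback f g

/-- The diagram `A ⇄ E ⇄ C'` (with `p₁, e₁` on the left and `p₂, e₂` on the right) is a local
product: `(E, p₁, p₂)` is the pullback of some `g` along some `f`, split by `s` and `r`, and
`e₁ = ⟨1, s f⟩`, `e₂ = ⟨r g, 1⟩`. -/
def IsLocalProduct {C : Type u} [Category.{v} C] {A E C' : C}
    (p₁ : E ⟶ A) (e₁ : A ⟶ E) (p₂ : E ⟶ C') (e₂ : C' ⟶ E) : Prop :=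
  ∃ (B : C) (f : A ⟶ B) (r : B ⟶ A) (g : C' ⟶ B) (s : B ⟶ C'),
    r ≫ f = 𝟙 B ∧ s ≫ g = 𝟙 B ∧ IsPullback p₁ p₂ f g ∧
    e₁ ≫ p₁ = 𝟙 A ∧ e₁ ≫ p₂ = f ≫ s ∧ e₂ ≫ p₁ = g ≫ r ∧ e₂ ≫ p₂ = 𝟙 C'

/-! ### Spans -/

/-- A span `(D, d, c)` whose two legs have kernel pairs. -/
structure Span (C : Type u) [Category.{v} C] where
  D : C
  D₀ : C
  D₁ : C
  d : D ⟶ D₀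
  c : D ⟶ D₁
  hasKernelPair_d : HasPullback d d
  hasKernelPair_c : HasPullback c c

attribute [instance] Span.hasKernelPair_d Span.hasKernelPair_c

namespace Span

variable {C : Type u} [Category.{v} C]

@[ext]
structure Hom (S T : Span C) where
  h : S.D ⟶ T.D
  h₀ : S.D₀ ⟶ T.D₀
  h₁ : S.D₁ ⟶ T.D₁
  w_d : h ≫ T.d = S.d ≫ h₀
  w_c : h ≫ T.c = S.c ≫ h₁

instance : Category (Span C) where
  Hom := Hom
  id S := ⟨𝟙 _, 𝟙 _, 𝟙 _, by simp, by simp⟩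
  comp f g := ⟨f.h ≫ g.h, f.h₀ ≫ g.h₀, f.h₁ ≫ g.h₁,
    by rw [Category.assoc, g.w_d, ← Category.assoc, f.w_d, Category.assoc],
    by rw [Category.assoc, g.w_c, ← Category.assoc, f.w_c, Category.assoc]⟩

/-- The legs of the span are jointly monic. -/
def JointlyMonic (S : Span C) : Prop :=
  ∀ ⦃Z : C⦄ (x y : Z ⟶ S.D), x ≫ S.d = y ≫ S.d → x ≫ S.c = y ≫ S.c → x = y

end Span

/-! ### Reflexive graphs -/

structure RG (C : Type u) [Category.{v} C] where
  C₁ : C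
  C₀ : C
  d : C₁ ⟶ C₀
  e : C₀ ⟶ C₁
  c : C₁ ⟶ C₀
  e_d : e ≫ d = 𝟙 C₀
  e_c : e ≫ c = 𝟙 C₀

namespace RG

variable {C : Type u} [Category.{v} C]

@[ext]
structure Hom (X Y : RG C) where
  f₁ : X.C₁ ⟶ Y.C₁
  f₀ : X.C₀ ⟶ Y.C₀
  w_d : f₁ ≫ Y.d = X.d ≫ f₀
  w_c : f₁ ≫ Y.c = X.c ≫ f₀
  w_e : X.e ≫ f₁ = f₀ ≫ Y.e

instance : Category (RG C) where
  Hom := Hom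
  id X := ⟨𝟙 _, 𝟙 _, by simp, by simp, by simp⟩
  comp f g := ⟨f.f₁ ≫ g.f₁, f.f₀ ≫ g.f₀,
    by rw [Category.assoc, g.w_d, ← Category.assoc, f.w_d, Category.assoc],
    by rw [Category.assoc, g.w_c, ← Category.assoc, f.w_c, Category.assoc],
    by rw [← Category.assoc, f.w_e, Category.assoc, g.w_e, Category.assoc]⟩

variable [HasLocalProducts C]

instance (X : RG C) : HasPullback X.d X.d :=
  HasLocalProducts.hasPullback X.d X.e X.d X.e X.e_d X.e_d

instance (X : RG C) : HasPullback X.c X.c :=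
  HasLocalProducts.hasPullback X.c X.e X.c X.e X.e_c X.e_c

/-- The object `C₂` of composable pairs exists: it is a local product. -/
instance (X : RG C) : HasPullback X.d X.c :=
  HasLocalProducts.hasPullback X.d X.e X.c X.e X.e_d X.e_c

/-- The span part of a reflexive graph. -/
def toSpan (X : RG C) : Span C where
  D := X.C₁
  D₀ := X.C₀
  D₁ := X.C₀
  d := X.d
  c := X.c
  hasKernelPair_d := inferInstance
  hasKernelPair_c := inferInstance

variable (C) in
def spanFunctor : RG C ⥤ Span C where
  obj := toSpan
  map f := ⟨f.f₁, f.f₀, f.f₀, f.w_d, f.w_c⟩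

/-- `f₂ = f₁ ×_{f₀} f₁` on objects of composable pairs. -/
noncomputable def Hom.f₂ {X Y : RG C} (f : Hom X Y) : pullback X.d X.c ⟶ pullback Y.d Y.c :=
  pullback.map X.d X.c Y.d Y.c f.f₁ f.f₁ f.f₀ f.w_d.symm f.w_c.symm

theorem f₂_id (X : RG C) : Hom.f₂ (𝟙 X) = 𝟙 _ := pullback.map_id

theorem f₂_comp {X Y Z : RG C} (f : X ⟶ Y) (g : Y ⟶ Z) :
    Hom.f₂ (f ≫ g) = Hom.f₂ f ≫ Hom.f₂ g :=
  (pullback.map_comp f.f₁ g.f₁ f.f₁ g.f₁ f.f₀ g.f₀ f.w_d.symm f.w_c.symm g.w_d.symm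
    g.w_c.symm).symm

/-- `e₁ = ⟨1, e d⟩`. -/
noncomputable def e₁ (X : RG C) : X.C₁ ⟶ pullback X.d X.c :=
  pullback.lift (𝟙 _) (X.d ≫ X.e) (by simp [X.e_c])

/-- `e₂ = ⟨e c, 1⟩`. -/
noncomputable def e₂ (X : RG C) : X.C₁ ⟶ pullback X.d X.c :=
  pullback.lift (X.c ≫ X.e) (𝟙 _) (by simp [X.e_d])

end RG

/-! ### The kernel pair construction -/

namespace Span

variable {C : Type u} [Category.{v} C] [HasLocalProducts C]

/-- Second projection of `D(d)` and first projection of `D(c)` are both split by the diagonal. -/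
instance (S : Span C) : HasPullback (pullback.snd S.d S.d) (pullback.fst S.c S.c) :=
  HasLocalProducts.hasPullback _ (pullback.lift (𝟙 _) (𝟙 _) rfl)
    _ (pullback.lift (𝟙 _) (𝟙 _) rfl) (pullback.lift_snd _ _ _) (pullback.lift_fst _ _ _)

/-- The object `D(d,c)` of triples `(x, y, z)` with `d x = d y` and `c y = c z`. -/
noncomputable abbrev triples (S : Span C) : C :=
  pullback (pullback.snd S.d S.d) (pullback.fst S.c S.c)

noncomputable def p₁ (S : Span C) : S.triples ⟶ pullback S.d S.d := pullback.fst _ _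

noncomputable def p₂ (S : Span C) : S.triples ⟶ pullback S.c S.c := pullback.snd _ _

/-- `(x, y, z) ↦ x`. -/
noncomputable def dom (S : Span C) : S.triples ⟶ S.D := S.p₁ ≫ pullback.fst S.d S.d

/-- `(x, y, z) ↦ z`. -/
noncomputable def cod (S : Span C) : S.triples ⟶ S.D := S.p₂ ≫ pullback.snd S.c S.c

/-- `(x, y) ↦ (x, y, y)`. -/
noncomputable def e₁ (S : Span C) : pullback S.d S.d ⟶ S.triples :=
  pullback.lift (𝟙 _) (pullback.snd S.d S.d ≫ pullback.lift (𝟙 _) (𝟙 _) rfl)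
    (by simp [pullback.lift_fst])

/-- `(y, z) ↦ (y, y, z)`. -/
noncomputable def e₂ (S : Span C) : pullback S.c S.c ⟶ S.triples :=
  pullback.lift (pullback.fst S.c S.c ≫ pullback.lift (𝟙 _) (𝟙 _) rfl) (𝟙 _)
    (by simp [pullback.lift_snd])

/-- `x ↦ (x, x, x)`. -/
noncomputable def diag (S : Span C) : S.D ⟶ S.triples :=
  pullback.lift (𝟙 S.D) (𝟙 S.D) rfl ≫ S.e₁

/-- The reflexive graph `(D(d,c), D, dom, Δ, cod)`. -/
noncomputable def kernelGraph (S : Span C) : RG C where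
  C₁ := S.triples
  C₀ := S.D
  d := S.dom
  e := S.diag
  c := S.cod
  e_d := by simp [diag, dom, e₁, p₁, pullback.lift_fst,
    pullback.lift_fst_assoc]
  e_c := by simp [diag, cod, e₁, p₂, pullback.lift_snd,
    pullback.lift_snd_assoc]

/-- The map `(x, y, z) ↦ (h x, h y, h z)` induced by a morphism of spans. -/
noncomputable def Hom.triplesMap {S T : Span C} (f : Hom S T) : S.triples ⟶ T.triples :=
  pullback.map _ _ _ _
    (pullback.map S.d S.d T.d T.d f.h f.h f.h₀ f.w_d.symm f.w_d.symm)
    (pullback.map S.c S.c T.c T.c f.h f.h f.h₁ f.w_c.symm f.w_c.symm)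
    f.h (pullback.lift_snd _ _ _).symm (pullback.lift_fst _ _ _).symm

theorem triplesMap_id (S : Span C) : Hom.triplesMap (𝟙 S) = 𝟙 _ := by
  apply pullback.hom_ext <;> apply pullback.hom_ext <;>
  simp only [Hom.triplesMap, pullback.lift_fst, pullback.lift_snd, Category.assoc,
    Category.id_comp] <;>
  exact congrArg _ (Category.comp_id _)

theorem triplesMap_comp {S T U : Span C} (f : S ⟶ T) (g : T ⟶ U) :
    Hom.triplesMap (f ≫ g) = Hom.triplesMap f ≫ Hom.triplesMap g := by
  apply pullback.hom_ext <;> apply pullback.hom_ext <;>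
  simp only [Hom.triplesMap, pullback.lift_fst, pullback.lift_snd, pullback.lift_fst_assoc,
    pullback.lift_snd_assoc, Category.assoc] <;>
  rfl

end Span

/-! ### Unital multiplicative graphs, internal categories, internal groupoids -/

section

variable (C : Type u) [Category.{v} C] [HasLocalProducts C]

/-- A unital multiplicative graph; `m` sends a composable pair `(x, y)`, `d x = c y`, to the
composite "`x` after `y`". -/
structure UMG where
  graph : RG C
  m : pullback graph.d graph.c ⟶ graph.C₁
  m_d : m ≫ graph.d = pullback.snd graph.d graph.c ≫ graph.d
  m_c : m ≫ graph.c = pullback.fst graph.d graph.c ≫ graph.c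
  e₁_m : graph.e₁ ≫ m = 𝟙 graph.C₁
  e₂_m : graph.e₂ ≫ m = 𝟙 graph.C₁

variable {C}

namespace UMG

@[ext]
structure Hom (X Y : UMG C) where
  hom : RG.Hom X.graph Y.graph
  w_m : X.m ≫ hom.f₁ = hom.f₂ ≫ Y.m

instance : Category (UMG C) where
  Hom := Hom
  id X := ⟨𝟙 X.graph, by
    rw [RG.f₂_id, Category.id_comp]
    exact Category.comp_id _⟩
  comp {X Y Z} f g := ⟨CategoryStruct.comp
    (X := X.graph) (Y := Y.graph) (Z := Z.graph) f.hom g.hom, by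
    rw [RG.f₂_comp, Category.assoc, ← g.w_m, ← Category.assoc, ← f.w_m, Category.assoc]
    rfl⟩

variable (C) in
/-- The forgetful functor to reflexive graphs. -/
def forget : UMG C ⥤ RG C where
  obj X := X.graph
  map f := f.hom

/-- The composite "`x` after `y`" of generalized elements with `d x = c y`. -/
noncomputable def mul (X : UMG C) {Z : C} (x y : Z ⟶ X.graph.C₁)
    (h : x ≫ X.graph.d = y ≫ X.graph.c) : Z ⟶ X.graph.C₁ :=
  pullback.lift x y h ≫ X.m

theorem mul_d (X : UMG C) {Z : C} (x y : Z ⟶ X.graph.C₁)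
    (h : x ≫ X.graph.d = y ≫ X.graph.c) : X.mul x y h ≫ X.graph.d = y ≫ X.graph.d := by
  simp [mul, X.m_d, pullback.lift_snd_assoc]

theorem mul_c (X : UMG C) {Z : C} (x y : Z ⟶ X.graph.C₁)
    (h : x ≫ X.graph.d = y ≫ X.graph.c) : X.mul x y h ≫ X.graph.c = x ≫ X.graph.c := by
  simp [mul, X.m_c, pullback.lift_fst_assoc]

/-- The multiplication is associative. -/
def IsAssociative : ObjectProperty (UMG C) := fun X =>
  ∀ ⦃Z : C⦄ (x y z : Z ⟶ X.graph.C₁) (hxy : x ≫ X.graph.d = y ≫ X.graph.c)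
    (hyz : y ≫ X.graph.d = z ≫ X.graph.c),
    X.mul (X.mul x y hxy) z ((X.mul_d x y hxy).trans hyz) =
      X.mul x (X.mul y z hyz) (hxy.trans (X.mul_c y z hyz).symm)

/-- There is an inversion morphism `i : C₁ ⟶ C₁`. -/
def HasInverses : ObjectProperty (UMG C) := fun X =>
  ∃ (i : X.graph.C₁ ⟶ X.graph.C₁) (hd : i ≫ X.graph.d = X.graph.c)
    (hc : i ≫ X.graph.c = X.graph.d),
    X.mul (𝟙 _) i (by rw [hc, Category.id_comp]) = X.graph.c ≫ X.graph.e ∧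
    X.mul i (𝟙 _) (by rw [hd, Category.id_comp]) = X.graph.d ≫ X.graph.e

end UMG

variable (C)

/-- Internal categories: associative unital multiplicative graphs. -/
abbrev ICat := (UMG.IsAssociative (C := C)).FullSubcategory

/-- Internal groupoids: internal categories with inverses. -/
abbrev IGrpd := (UMG.HasInverses.inverseImage (UMG.IsAssociative (C := C)).ι).FullSubcategory

/-- The forgetful functor from internal categories to reflexive graphs. -/
abbrev ICat.forget : ICat C ⥤ RG C := UMG.IsAssociative.ι ⋙ UMG.forget C

/-- The forgetful functor from internal groupoids to reflexive graphs. -/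
abbrev IGrpd.forget : IGrpd C ⥤ RG C :=
  (UMG.HasInverses.inverseImage (UMG.IsAssociative (C := C)).ι).ι ⋙ ICat.forget C

end

/-! ### Pregroupoids -/

section

variable (C : Type u) [Category.{v} C] [HasLocalProducts C]

/-- A pregroupoid: a span with `p : D(d,c) ⟶ D` such that `p(x,y,y) = x`, `p(y,y,z) = z`,
`d p(x,y,z) = d z` and `c p(x,y,z) = c x`. -/
structure PreGrpd where
  span : Span C
  p : span.triples ⟶ span.D
  e₁_p : span.e₁ ≫ p = pullback.fst span.d span.d
  e₂_p : span.e₂ ≫ p = pullback.snd span.c span.c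
  p_d : p ≫ span.d = span.p₂ ≫ pullback.snd span.c span.c ≫ span.d
  p_c : p ≫ span.c = span.p₁ ≫ pullback.fst span.d span.d ≫ span.c

namespace PreGrpd

variable {C}

@[ext]
structure Hom (X Y : PreGrpd C) where
  hom : Span.Hom X.span Y.span
  w_p : X.p ≫ hom.h = hom.triplesMap ≫ Y.p

instance : Category (PreGrpd C) where
  Hom := Hom
  id X := ⟨𝟙 X.span, by
    rw [Span.triplesMap_id, Category.id_comp]
    exact Category.comp_id _⟩
  comp {X Y Z} f g := ⟨CategoryStruct.comp
    (X := X.span) (Y := Y.span) (Z := Z.span) f.hom g.hom, by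
    rw [Span.triplesMap_comp, Category.assoc, ← g.w_p, ← Category.assoc, ← f.w_p, Category.assoc]
    rfl⟩

variable (C) in
/-- The forgetful functor to spans. -/
def forget : PreGrpd C ⥤ Span C where
  obj X := X.span
  map f := f.hom

end PreGrpd

end

/-! ### Directed kites -/

/-- A directed kite: a kite `f r = 1 = g s`, `α r = β = γ s`, with a span `(D, d, c)` such that
`d α = d β f` and `c β g = c γ`. -/
structure DiKite (C : Type u) [Category.{v} C] where
  A : C
  B : C
  C' : C
  span : Span C
  f : A ⟶ B
  r : B ⟶ A
  g : C' ⟶ B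
  s : B ⟶ C'
  α : A ⟶ span.D
  β : B ⟶ span.D
  γ : C' ⟶ span.D
  r_f : r ≫ f = 𝟙 B
  s_g : s ≫ g = 𝟙 B
  r_α : r ≫ α = β
  s_γ : s ≫ γ = β
  α_d : α ≫ span.d = f ≫ β ≫ span.d
  γ_c : γ ≫ span.c = g ≫ β ≫ span.c

namespace DiKite

variable {C : Type u} [Category.{v} C]

@[ext]
structure Hom (X Y : DiKite C) where
  hA : X.A ⟶ Y.A
  hB : X.B ⟶ Y.B
  hC : X.C' ⟶ Y.C'
  hom : Span.Hom X.span Y.span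
  w_f : hA ≫ Y.f = X.f ≫ hB
  w_r : hB ≫ Y.r = X.r ≫ hA
  w_g : hC ≫ Y.g = X.g ≫ hB
  w_s : hB ≫ Y.s = X.s ≫ hC
  w_α : hA ≫ Y.α = X.α ≫ hom.h
  w_β : hB ≫ Y.β = X.β ≫ hom.h
  w_γ : hC ≫ Y.γ = X.γ ≫ hom.h

theorem paste {X Y Z X' Y' Z' : C} {a : X ⟶ Y} {b : Y ⟶ Z} {k : X ⟶ X'} {l : Y ⟶ Y'} {n : Z ⟶ Z'}
    {a' : X' ⟶ Y'} {b' : Y' ⟶ Z'} (h : a ≫ l = k ≫ a') (h' : b ≫ n = l ≫ b') :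
    (a ≫ b) ≫ n = k ≫ a' ≫ b' := by
  rw [Category.assoc, h', ← Category.assoc, h, Category.assoc]

instance : Category (DiKite C) where
  Hom := Hom
  id X := ⟨𝟙 _, 𝟙 _, 𝟙 _, 𝟙 X.span, by simp, by simp, by simp, by simp,
    (Category.id_comp _).trans (Category.comp_id _).symm,
    (Category.id_comp _).trans (Category.comp_id _).symm,
    (Category.id_comp _).trans (Category.comp_id _).symm⟩
  comp {X Y Z} f g := ⟨f.hA ≫ g.hA, f.hB ≫ g.hB, f.hC ≫ g.hC,
    (show X.span ⟶ Y.span from f.hom) ≫ (show Y.span ⟶ Z.span from g.hom),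
    paste f.w_f g.w_f, paste f.w_r g.w_r, paste f.w_g g.w_g, paste f.w_s g.w_s,
    paste f.w_α g.w_α, paste f.w_β g.w_β, paste f.w_γ g.w_γ⟩

variable (C) in
/-- The direction of a directed kite. -/
def spanFunctor : DiKite C ⥤ Span C where
  obj X := X.span
  map f := f.hom

variable [HasLocalProducts C]

instance (X : DiKite C) : HasPullback X.f X.g :=
  HasLocalProducts.hasPullback X.f X.r X.g X.s X.r_f X.s_g

/-- `e₁ = ⟨1, s f⟩`. -/
noncomputable def e₁ (X : DiKite C) : X.A ⟶ pullback X.f X.g :=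
  pullback.lift (𝟙 _) (X.f ≫ X.s) (by simp [X.s_g])

/-- `e₂ = ⟨r g, 1⟩`. -/
noncomputable def e₂ (X : DiKite C) : X.C' ⟶ pullback X.f X.g :=
  pullback.lift (X.g ≫ X.r) (𝟙 _) (by simp [X.r_f])

/-- The morphism `h_A ×_{h_B} h_C` of local products. -/
noncomputable def Hom.pullbackMap {X Y : DiKite C} (h : Hom X Y) :
    pullback X.f X.g ⟶ pullback Y.f Y.g :=
  pullback.map X.f X.g Y.f Y.g h.hA h.hC h.hB h.w_f.symm h.w_g.symm

theorem pullbackMap_id (X : DiKite C) : Hom.pullbackMap (𝟙 X) = 𝟙 _ := pullback.map_id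

theorem pullbackMap_comp {X Y Z : DiKite C} (f : X ⟶ Y) (g : Y ⟶ Z) :
    Hom.pullbackMap (f ≫ g) = Hom.pullbackMap f ≫ Hom.pullbackMap g :=
  (pullback.map_comp f.hA g.hA f.hC g.hC f.hB g.hB f.w_f.symm f.w_g.symm g.w_f.symm
    g.w_g.symm).symm

end DiKite

section

variable (C : Type u) [Category.{v} C] [HasLocalProducts C]

/-- A multiplicative directed kite. -/
structure MKite where
  kite : DiKite C
  m : pullback kite.f kite.g ⟶ kite.span.D
  m_d : m ≫ kite.span.d = pullback.snd kite.f kite.g ≫ kite.γ ≫ kite.span.d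
  m_c : m ≫ kite.span.c = pullback.fst kite.f kite.g ≫ kite.α ≫ kite.span.c
  e₁_m : kite.e₁ ≫ m = kite.α
  e₂_m : kite.e₂ ≫ m = kite.γ

namespace MKite

variable {C}

@[ext]
structure Hom (X Y : MKite C) where
  hom : DiKite.Hom X.kite Y.kite
  w_m : X.m ≫ hom.hom.h = hom.pullbackMap ≫ Y.m

instance : Category (MKite C) where
  Hom := Hom
  id X := ⟨𝟙 X.kite, by
    rw [DiKite.pullbackMap_id, Category.id_comp]
    exact Category.comp_id _⟩
  comp {X Y Z} f g := ⟨CategoryStruct.comp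
    (X := X.kite) (Y := Y.kite) (Z := Z.kite) f.hom g.hom, by
    rw [DiKite.pullbackMap_comp, Category.assoc, ← g.w_m, ← Category.assoc, ← f.w_m, Category.assoc]
    rfl⟩

variable (C) in
/-- The forgetful functor to directed kites. -/
def forget : MKite C ⥤ DiKite C where
  obj X := X.kite
  map f := f.hom

end MKite

end

/-! ### Functors -/

section

universe v₁ v₂ u₁ u₂

variable {X : Type u₁} [Category.{v₁} X] {Y : Type u₂} [Category.{v₂} Y]

/-- An isomorphism of categories (not merely an equivalence). -/
def IsIsoOfCategories (F : X ⥤ Y) : Prop := ∃ G : Y ⥤ X, F ⋙ G = 𝟭 X ∧ G ⋙ F = 𝟭 Y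

/-- `F` has a section: a functor `G` with `F G = 1`. -/
def HasSection (F : X ⥤ Y) : Prop := ∃ G : Y ⥤ X, G ⋙ F = 𝟭 Y

/-- The pullback of `F` along the inclusion of the full subcategory of `Y` given by `P`. -/
def restrict (F : X ⥤ Y) (P : ObjectProperty Y) :
    (P.inverseImage F).FullSubcategory ⥤ P.FullSubcategory :=
  P.lift ((P.inverseImage F).ι ⋙ F) fun x => x.property

end

/-! ### Notions relative to a class of spans -/

section

variable {C : Type u} [Category.{v} C] [HasLocalProducts C] (M : ObjectProperty (Span C))

/-- If `(D, d, c)` is in `M` then so is `(D(d,c), dom, cod)`. -/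
def ClosedUnderKernelPairs : Prop := ∀ S : Span C, M S → M S.kernelGraph.toSpan

/-- `M` contains the span part of every local product. -/
def ContainsLocalProducts : Prop :=
  ∀ (S : Span C) (e₁ : S.D₀ ⟶ S.D) (e₂ : S.D₁ ⟶ S.D), IsLocalProduct S.d e₁ S.c e₂ → M S

/-- `Grpd(C, M) ⥤ RG(C, M)`. -/
def grpdToRG := restrict (IGrpd.forget C) (M.inverseImage (RG.spanFunctor C))

/-- `Cat(C, M) ⥤ RG(C, M)`. -/
def catToRG := restrict (ICat.forget C) (M.inverseImage (RG.spanFunctor C))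

/-- `UMG(C, M) ⥤ RG(C, M)`. -/
def umgToRG := restrict (UMG.forget C) (M.inverseImage (RG.spanFunctor C))

/-- `PreGrpd(C, M) ⥤ Span(C, M)`. -/
def preGrpdToSpan := restrict (PreGrpd.forget C) M

/-- `MKite(C, M) ⥤ DiKite(C, M)`. -/
def mKiteToDiKite := restrict (MKite.forget C) (M.inverseImage (DiKite.spanFunctor C))

/-- The Kite Condition relative to `M`. Here `S` is the span `(D, d, c)` and `T` is the span
`(E, p₁, p₂)` with `p₁ = T.d : E ⟶ A` and `p₂ = T.c : E ⟶ C'`. -/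
def KiteCondition : Prop :=
  ∀ (S T : Span C), M S → M T → T.JointlyMonic →
    ∀ (e₁ : T.D₀ ⟶ T.D) (e₂ : T.D₁ ⟶ T.D)
      (α : T.D₀ ⟶ S.D) (β : T.D ⟶ S.D) (γ : T.D₁ ⟶ S.D),
      e₁ ≫ T.d = 𝟙 T.D₀ → e₂ ≫ T.c = 𝟙 T.D₁ →
      (T.c ≫ e₂) ≫ (T.d ≫ e₁) = (T.d ≫ e₁) ≫ (T.c ≫ e₂) →
      (T.c ≫ e₂ ≫ T.d) ≫ α = β → (T.d ≫ e₁ ≫ T.c) ≫ γ = β →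
      T.d ≫ α ≫ S.d = (T.c ≫ e₂ ≫ T.d) ≫ α ≫ S.d →
      T.c ≫ γ ≫ S.c = (T.d ≫ e₁ ≫ T.c) ≫ γ ≫ S.c →
      ∃! m : T.D ⟶ S.D, e₁ ≫ m = α ∧ e₂ ≫ m = γ ∧
        m ≫ S.d = T.c ≫ γ ≫ S.d ∧ m ≫ S.c = T.d ≫ α ≫ S.c

end

end RelMaltsev

namespace RelMaltsev

/-! ### Restrictions of functors to full subcategories -/

section

universe v₁ v₂ u₁ u₂

variable {X : Type u₁} [Category.{v₁} X] {Y : Type u₂} [Category.{v₂} Y]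

/-! Every section yields a natural choice of Mal'tsev operations p(x,y,z), for dx = dy and cy = cz,
on the spans in `M` (`NaturalMaltsev`). For pregroupoids this is immediate. For kites, use D(d) ⇄ D
⇄ D(c), whose multiplications are exactly these operations. For reflexive graphs, multiply (y,x,x)
and (z,z,y) in the kernel graph: the product is a triple (z, p(x,y,z), x). Only this last case needs
closure under the kernel pair construction.

Given such p, existence in the Kite Condition is m = p(αp₁, β, γp₂). Uniqueness is the crux
(`hom_op_eq_triple`). A solution m is a span morphism out of (E, p₂, p₁), which need not lie in `M`,
so naturality does not apply to m itself. It does apply to the composite of m with q(x,y,z) =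
p(z,y,x), whose domain is a local product and therefore carries a span in `M`. There `hom_eq_triple`
gives m q(x,y,z) = p(mx, my, mz). With a = e₁p₁ and b = e₂p₂, joint monicity forces q(a, ab, b) = 1,
so m = p(ma, mab, mb) is determined by the data.

Conversely, the Kite Condition applied to local products gives every directed kite over a span in
`M` exactly one multiplication (`UniqueMul`). Uniqueness alone then yields the rest: two
multiplications on one kite agree, which proves naturality, associativity and, through x v⁻¹ w = x ·
(1 v⁻¹ w), the existence of inverses. -/

theorem IsIsoOfCategories.hasSection {F : X ⥤ Y} (h : IsIsoOfCategories F) : HasSection F :=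
  let ⟨G, _, hG⟩ := h
  ⟨G, hG⟩

/-- A functor that is fully faithful and bijective on objects is an isomorphism. -/
theorem isIsoOfCategories_of_bijective (F : X ⥤ Y) [F.Faithful] [F.Full]
    (h : ∀ y, ∃! x, F.obj x = y) : IsIsoOfCategories F := by
  choose g hg hu using h
  refine ⟨{ obj := g
            map := fun {y y'} f =>
              -- The chosen preimages lie over the given objects only up to propositional equality,
              -- hence the conjugation.
              F.preimage (eqToHom (hg y) ≫ f ≫ eqToHom (hg y').symm)
            map_id := fun y => F.map_injective (by simp)
            map_comp := fun f f' => F.map_injective (by simp) }, ?_, ?_⟩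
  · refine CategoryTheory.Functor.ext (fun x => (hu (F.obj x) x rfl).symm) fun x x' f =>
      F.map_injective ?_
    simp [eqToHom_map]
  · exact CategoryTheory.Functor.ext hg fun y y' f => by simp

/-- Over the objects satisfying `P`, the functor `F` is fully faithful and bijective on objects. -/
structure BijectiveOver (F : X ⥤ Y) (P : ObjectProperty Y) : Prop where
  faithful : F.Faithful
  full : ∀ {x x' : X}, P (F.obj x) → P (F.obj x') → ∀ f : F.obj x ⟶ F.obj x', ∃ φ, F.map φ = f
  existsUnique : ∀ y, P y → ∃! x, F.obj x = y

theorem BijectiveOver.isIsoOfCategories {F : X ⥤ Y} {P : ObjectProperty Y}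
    (h : BijectiveOver F P) : IsIsoOfCategories (restrict F P) := by
  have := h.faithful
  have hf : (restrict F P).Faithful :=
    ⟨fun {x x'} a b hab => by
      apply ObjectProperty.hom_ext
      exact F.map_injective (congrArg (fun k => k.hom) hab)⟩
  have hF : (restrict F P).Full :=
    ⟨fun {x x'} f => by
      obtain ⟨φ, hφ⟩ := h.full x.property x'.property f.hom
      exact ⟨ObjectProperty.homMk φ, by apply ObjectProperty.hom_ext; exact hφ⟩⟩
  refine isIsoOfCategories_of_bijective _ fun y => ?_
  obtain ⟨x, hx, hu⟩ := h.existsUnique y.obj y.property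
  refine ⟨⟨x, by simpa [hx] using y.property⟩, ?_, fun x' hx' => ?_⟩
  · cases y; cases hx; rfl
  · have := hu x'.obj (congrArg (fun k => k.obj) hx')
    cases x'; cases this; rfl

/-- A property that holds automatically over `P` costs nothing. This passes from multiplicative
graphs to categories and then to groupoids. -/
theorem BijectiveOver.comp_ι {F : X ⥤ Y} {P : ObjectProperty Y} (h : BijectiveOver F P)
    (Q : ObjectProperty X) (hQ : ∀ x, P (F.obj x) → Q x) : BijectiveOver (Q.ι ⋙ F) P where
  faithful := by
    have := h.faithful
    infer_instance
  full hx hx' f := by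
    obtain ⟨φ, hφ⟩ := h.full hx hx' f
    exact ⟨ObjectProperty.homMk φ, hφ⟩
  existsUnique y hy := by
    obtain ⟨x, hx, hu⟩ := h.existsUnique y hy
    refine ⟨⟨x, hQ x (by simpa [hx] using hy)⟩, hx, fun x' hx' => ?_⟩
    have := hu x'.obj hx'
    cases x'; cases this; rfl

theorem HasSection.of_restrict_comp_ι {F : X ⥤ Y} {P : ObjectProperty Y} {Q : ObjectProperty X}
    (h : HasSection (restrict (Q.ι ⋙ F) P)) : HasSection (restrict F P) := by
  obtain ⟨G, hG⟩ := h
  exact ⟨G ⋙ (P.inverseImage F).lift ((P.inverseImage (Q.ι ⋙ F)).ι ⋙ Q.ι) fun x => x.property, hG⟩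

/-- The values of a section of `restrict F P`, in unbundled form. -/
theorem HasSection.exists_lift {F : X ⥤ Y} {P : ObjectProperty Y}
    (h : HasSection (restrict F P)) :
    ∃ (g : ∀ y, P y → X) (hg : ∀ y hy, F.obj (g y hy) = y),
      ∀ (y y' : Y) (hy : P y) (hy' : P y') (f : y ⟶ y'), ∃ φ : g y hy ⟶ g y' hy',
        F.map φ = eqToHom (hg y hy) ≫ f ≫ eqToHom (hg y' hy').symm := by
  obtain ⟨G, hG⟩ := h
  refine ⟨fun y hy => (G.obj ⟨y, hy⟩).obj,
    fun y hy => congrArg (fun k => k.obj) (Functor.congr_obj hG ⟨y, hy⟩),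
    fun y y' hy hy' f => ⟨(G.map (ObjectProperty.homMk f)).hom, ?_⟩⟩
  have := congrArg (fun k => k.hom) (Functor.congr_hom hG
    (ObjectProperty.homMk f : (⟨y, hy⟩ : P.FullSubcategory) ⟶ ⟨y', hy'⟩))
  refine Eq.trans this ?_
  have key : ∀ {a b : P.FullSubcategory} (e : a = b),
      (eqToHom e).hom = eqToHom (congrArg (fun k => k.obj) e) := by
    rintro a _ rfl; rfl
  simp [key]
  rfl

end

/-! ### Generalized triples and Mal'tsev operations on spans -/

section

variable {C : Type u} [Category.{v} C] [HasLocalProducts C]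

attribute [local simp] pullback.lift_fst pullback.lift_snd pullback.lift_fst_assoc
  pullback.lift_snd_assoc

namespace Span

/-- `(x, y, z) ↦ y`. -/
noncomputable def mid (S : Span C) : S.triples ⟶ S.D := S.p₁ ≫ pullback.snd S.d S.d

theorem p₂_fst (S : Span C) : S.p₂ ≫ pullback.fst S.c S.c = S.mid :=
  pullback.condition.symm

theorem dom_d (S : Span C) : S.dom ≫ S.d = S.mid ≫ S.d := by
  simp [dom, mid, pullback.condition]

theorem mid_c (S : Span C) : S.mid ≫ S.c = S.cod ≫ S.c := by
  simp [← p₂_fst, cod, pullback.condition]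

/-- The middle entry can be read off either kernel pair, so three entries suffice instead of four.
-/
theorem triples_ext {S : Span C} {Z : C} {a b : Z ⟶ S.triples}
    (h₁ : a ≫ S.dom = b ≫ S.dom) (h₂ : a ≫ S.mid = b ≫ S.mid) (h₃ : a ≫ S.cod = b ≫ S.cod) :
    a = b := by
  have h₂' := h₂
  rw [← p₂_fst] at h₂'
  simp only [dom, mid, cod, p₁, p₂] at h₁ h₂ h₂' h₃
  apply pullback.hom_ext <;> apply pullback.hom_ext <;> simpa

/-- The generalized element `(x, y, z)` of `S.triples`. -/
noncomputable def triple (S : Span C) {Z : C} (x y z : Z ⟶ S.D) (h : x ≫ S.d = y ≫ S.d)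
    (h' : y ≫ S.c = z ≫ S.c) : Z ⟶ S.triples :=
  pullback.lift (pullback.lift x y h) (pullback.lift y z h') (by simp)

section

variable (S : Span C) {Z : C} (x y z : Z ⟶ S.D) (h : x ≫ S.d = y ≫ S.d) (h' : y ≫ S.c = z ≫ S.c)

@[simp]
theorem triple_dom : S.triple x y z h h' ≫ S.dom = x := by simp [triple, dom, p₁]

@[simp]
theorem triple_mid : S.triple x y z h h' ≫ S.mid = y := by simp [triple, mid, p₁]

@[simp]
theorem triple_cod : S.triple x y z h h' ≫ S.cod = z := by simp [triple, cod, p₂]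

end

theorem comp_triple (S : Span C) {Z W : C} (a : W ⟶ Z) (x y z : Z ⟶ S.D)
    (h : x ≫ S.d = y ≫ S.d) (h' : y ≫ S.c = z ≫ S.c) :
    a ≫ S.triple x y z h h' =
      S.triple (a ≫ x) (a ≫ y) (a ≫ z) (by simp [h]) (by simp [h']) := by
  apply triples_ext <;> simp

theorem e₁_eq_triple (S : Span C) : S.e₁ =
    S.triple (pullback.fst _ _) (pullback.snd _ _) (pullback.snd _ _) pullback.condition rfl := by
  apply triples_ext <;> simp [triple, e₁, dom, mid, cod, p₁, p₂]

theorem e₂_eq_triple (S : Span C) : S.e₂ =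
    S.triple (pullback.fst _ _) (pullback.fst _ _) (pullback.snd _ _) rfl pullback.condition := by
  apply triples_ext <;> simp [triple, e₂, dom, mid, cod, p₁, p₂]

theorem diag_eq_triple (S : Span C) : S.diag = S.triple (𝟙 _) (𝟙 _) (𝟙 _) rfl rfl := by
  apply triples_ext <;> simp [triple, diag, e₁, dom, mid, cod, p₁, p₂]

section

variable {S T : Span C} (f : Hom S T)

@[simp]
theorem Hom.triplesMap_dom : f.triplesMap ≫ T.dom = S.dom ≫ f.h := by
  simp [triplesMap, dom, p₁]

@[simp]
theorem Hom.triplesMap_mid : f.triplesMap ≫ T.mid = S.mid ≫ f.h := by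
  simp [triplesMap, mid, p₁]

@[simp]
theorem Hom.triplesMap_cod : f.triplesMap ≫ T.cod = S.cod ≫ f.h := by
  simp [triplesMap, cod, p₂]

theorem triple_triplesMap {Z : C} (x y z : Z ⟶ S.D)
    (h : x ≫ S.d = y ≫ S.d) (h' : y ≫ S.c = z ≫ S.c) :
    S.triple x y z h h' ≫ f.triplesMap = T.triple (x ≫ f.h) (y ≫ f.h) (z ≫ f.h)
      (by simp [f.w_d, reassoc_of% h]) (by simp [f.w_c, reassoc_of% h']) := by
  apply triples_ext <;> simp [reassoc_of% triple_dom, reassoc_of% triple_mid,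
    reassoc_of% triple_cod]

end

/-- `p` is the operation of a pregroupoid with underlying span `S`. -/
structure IsMaltsev (S : Span C) (p : S.triples ⟶ S.D) : Prop where
  triple_left : ∀ {Z : C} (x y : Z ⟶ S.D) (h : x ≫ S.d = y ≫ S.d), S.triple x y y h rfl ≫ p = x
  triple_right : ∀ {Z : C} (y z : Z ⟶ S.D) (h : y ≫ S.c = z ≫ S.c), S.triple y y z rfl h ≫ p = z
  comp_d : p ≫ S.d = S.cod ≫ S.d
  comp_c : p ≫ S.c = S.dom ≫ S.c

namespace IsMaltsev

variable {S : Span C} {p : S.triples ⟶ S.D} (hp : S.IsMaltsev p)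
include hp

theorem triple_comp_d {Z : C} (x y z : Z ⟶ S.D) (h : x ≫ S.d = y ≫ S.d)
    (h' : y ≫ S.c = z ≫ S.c) : (S.triple x y z h h' ≫ p) ≫ S.d = z ≫ S.d := by
  rw [Category.assoc, hp.comp_d, ← Category.assoc, triple_cod]

theorem triple_comp_c {Z : C} (x y z : Z ⟶ S.D) (h : x ≫ S.d = y ≫ S.d)
    (h' : y ≫ S.c = z ≫ S.c) : (S.triple x y z h h' ≫ p) ≫ S.c = x ≫ S.c := by
  rw [Category.assoc, hp.comp_c, ← Category.assoc, triple_dom]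

end IsMaltsev

end Span

theorem PreGrpd.isMaltsev (X : PreGrpd C) : X.span.IsMaltsev X.p where
  triple_left x y h := by
    have : X.span.triple x y y h rfl = pullback.lift x y h ≫ X.span.e₁ := by
      rw [Span.e₁_eq_triple, Span.comp_triple]; simp
    rw [this, Category.assoc, X.e₁_p, pullback.lift_fst]
  triple_right y z h := by
    have : X.span.triple y y z rfl h = pullback.lift y z h ≫ X.span.e₂ := by
      rw [Span.e₂_eq_triple, Span.comp_triple]; simp
    rw [this, Category.assoc, X.e₂_p, pullback.lift_snd]
  comp_d := by rw [X.p_d, Span.cod, Category.assoc]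
  comp_c := by rw [X.p_c, Span.dom, Category.assoc]

/-- The pregroupoid given by a Mal'tsev operation on a span. -/
noncomputable def Span.IsMaltsev.preGrpd {S : Span C} {p : S.triples ⟶ S.D}
    (hp : S.IsMaltsev p) : PreGrpd C where
  span := S
  p := p
  e₁_p := by rw [S.e₁_eq_triple, hp.triple_left]
  e₂_p := by rw [S.e₂_eq_triple, hp.triple_right]
  p_d := by rw [hp.comp_d, Span.cod, Category.assoc]
  p_c := by rw [hp.comp_c, Span.dom, Category.assoc]

/-- A natural choice of Mal'tsev operations on the spans in `M`. -/
structure NaturalMaltsev (M : ObjectProperty (Span C)) where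
  p : ∀ S : Span C, M S → (S.triples ⟶ S.D)
  isMaltsev : ∀ (S : Span C) hS, S.IsMaltsev (p S hS)
  naturality : ∀ {S T : Span C} (hS : M S) (hT : M T) (f : Span.Hom S T),
    p S hS ≫ f.h = f.triplesMap ≫ p T hT

theorem NaturalMaltsev.triple_comp {M : ObjectProperty (Span C)} (P : NaturalMaltsev M)
    {S T : Span C} (hS : M S) (hT : M T) (f : Span.Hom S T) {Z : C} (x y z : Z ⟶ S.D)
    (h : x ≫ S.d = y ≫ S.d) (h' : y ≫ S.c = z ≫ S.c) :
    S.triple x y z h h' ≫ P.p S hS ≫ f.h = T.triple (x ≫ f.h) (y ≫ f.h) (z ≫ f.h)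
      (by simp [f.w_d, reassoc_of% h]) (by simp [f.w_c, reassoc_of% h']) ≫ P.p T hT := by
  rw [P.naturality hS hT, ← Category.assoc, Span.triple_triplesMap]

/-! ### Natural Mal'tsev operations from sections -/

theorem nonempty_naturalMaltsev_of_preGrpd {M : ObjectProperty (Span C)}
    (h : HasSection (preGrpdToSpan M)) : Nonempty (NaturalMaltsev M) := by
  obtain ⟨G, hG, hn⟩ := HasSection.exists_lift h
  -- The section returns the given span only up to equality of objects. The operation is therefore
  -- transported to `S`, and the heterogeneous equality records its origin so that naturality can be
  -- transported later by substitution.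
  have key : ∀ S hS, ∃ p : S.triples ⟶ S.D, S.IsMaltsev p ∧
      ((G S hS).p ≍ p) := by
    intro S hS
    have := (G S hS).isMaltsev
    have e : (G S hS).span = S := hG S hS
    revert e
    generalize G S hS = X at *
    rintro rfl
    exact ⟨_, this, HEq.rfl⟩
  choose p hp hpG using key
  refine ⟨⟨p, hp, fun {S T} hS hT f => ?_⟩⟩
  obtain ⟨φ, hφ⟩ := hn S T hS hT f
  have eS : (G S hS).span = S := hG S hS
  have eT : (G T hT).span = T := hG T hT
  have pS := hpG S hS
  have pT := hpG T hT
  change φ.hom = eqToHom eS ≫ f ≫ eqToHom eT.symm at hφ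
  generalize G S hS = X at *
  generalize G T hT = Y at *
  generalize p S hS = q at *
  generalize p T hT = q' at *
  subst eS eT
  obtain rfl := eq_of_heq pS
  obtain rfl := eq_of_heq pT
  simp only [eqToHom_refl, Category.comp_id, Category.id_comp] at hφ
  subst hφ
  exact φ.w_p

/-- `m` makes the directed kite `X` multiplicative. -/
structure DiKite.IsMul (X : DiKite C) (m : pullback X.f X.g ⟶ X.span.D) : Prop where
  comp_d : m ≫ X.span.d = pullback.snd X.f X.g ≫ X.γ ≫ X.span.d
  comp_c : m ≫ X.span.c = pullback.fst X.f X.g ≫ X.α ≫ X.span.c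
  e₁_comp : X.e₁ ≫ m = X.α
  e₂_comp : X.e₂ ≫ m = X.γ

theorem MKite.isMul (X : MKite C) : X.kite.IsMul X.m := ⟨X.m_d, X.m_c, X.e₁_m, X.e₂_m⟩

/-! ### The directed kite of a span -/

namespace Span

/-- The directed kite `D(d) ⇄ D ⇄ D(c)` over the span `(D, d, c)`. -/
noncomputable abbrev kernelKite (S : Span C) : DiKite C where
  A := pullback S.d S.d
  B := S.D
  C' := pullback S.c S.c
  span := S
  f := pullback.snd _ _
  r := pullback.lift (𝟙 _) (𝟙 _) rfl
  g := pullback.fst _ _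
  s := pullback.lift (𝟙 _) (𝟙 _) rfl
  α := pullback.fst _ _
  β := 𝟙 _
  γ := pullback.snd _ _
  r_f := by simp
  s_g := by simp
  r_α := by simp
  s_γ := by simp
  α_d := by simp [pullback.condition]
  γ_c := by simp [pullback.condition]

/-- The local product of the kernel kite is the object of triples, and the axioms of a
multiplication on it are literally those of a pregroupoid. -/
theorem kernelKite_isMul_iff (S : Span C) (p : S.triples ⟶ S.D) :
    S.kernelKite.IsMul p ↔ S.IsMaltsev p := by
  constructor
  · intro h
    exact PreGrpd.isMaltsev
      { span := S, p := p, e₁_p := h.e₁_comp, e₂_p := h.e₂_comp, p_d := h.comp_d, p_c := h.comp_c }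
  · intro h
    exact ⟨h.preGrpd.p_d, h.preGrpd.p_c, h.preGrpd.e₁_p, h.preGrpd.e₂_p⟩

/-- The morphism of kernel kites induced by a morphism of spans. -/
noncomputable def Hom.kernelKiteMap {S T : Span C} (f : Hom S T) :
    DiKite.Hom S.kernelKite T.kernelKite where
  hA := pullback.map S.d S.d T.d T.d f.h f.h f.h₀ f.w_d.symm f.w_d.symm
  hB := f.h
  hC := pullback.map S.c S.c T.c T.c f.h f.h f.h₁ f.w_c.symm f.w_c.symm
  hom := f
  w_f := pullback.lift_snd _ _ _
  w_r := by apply pullback.hom_ext <;> simp [kernelKite]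
  w_g := pullback.lift_fst _ _ _
  w_s := by apply pullback.hom_ext <;> simp [kernelKite]
  w_α := pullback.lift_fst _ _ _
  w_β := (Category.comp_id _).trans (Category.id_comp _).symm
  w_γ := pullback.lift_snd _ _ _

/-- The morphism of kernel graphs induced by a morphism of spans. -/
noncomputable def Hom.kernelGraphMap {S T : Span C} (f : Hom S T) :
    RG.Hom S.kernelGraph T.kernelGraph where
  f₁ := f.triplesMap
  f₀ := f.h
  w_d := f.triplesMap_dom
  w_c := f.triplesMap_cod
  w_e := by
    simp only [kernelGraph, diag_eq_triple, triple_triplesMap, comp_triple]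
    simp

end Span

theorem nonempty_naturalMaltsev_of_mKite {M : ObjectProperty (Span C)}
    (h : HasSection (mKiteToDiKite M)) : Nonempty (NaturalMaltsev M) := by
  obtain ⟨G, hG, hn⟩ := HasSection.exists_lift h
  have key : ∀ (X : DiKite C) (hX : M X.span), ∃ m : pullback X.f X.g ⟶ X.span.D, X.IsMul m ∧
      ((G X hX).m ≍ m) := by
    intro X hX
    have := (G X hX).isMul
    have e : (G X hX).kite = X := hG X hX
    revert e
    generalize G X hX = Y at *
    rintro rfl
    exact ⟨_, this, HEq.rfl⟩
  choose m hm hmG using key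
  have nat : ∀ {X Y : DiKite C} (hX : M X.span) (hY : M Y.span) (f : DiKite.Hom X Y),
      m X hX ≫ f.hom.h = f.pullbackMap ≫ m Y hY := by
    intro X Y hX hY f
    obtain ⟨φ, hφ⟩ := hn X Y hX hY f
    have eX : (G X hX).kite = X := hG X hX
    have eY : (G Y hY).kite = Y := hG Y hY
    have mX := hmG X hX
    have mY := hmG Y hY
    change φ.hom = eqToHom eX ≫ f ≫ eqToHom eY.symm at hφ
    generalize G X hX = X' at *
    generalize G Y hY = Y' at *
    generalize m X hX = q at *
    generalize m Y hY = q' at *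
    subst eX eY
    obtain rfl := eq_of_heq mX
    obtain rfl := eq_of_heq mY
    simp only [eqToHom_refl, Category.comp_id, Category.id_comp] at hφ
    subst hφ
    exact φ.w_m
  exact ⟨{ p := fun S hS => m S.kernelKite hS
           isMaltsev := fun S hS => (S.kernelKite_isMul_iff _).1 (hm _ _)
           naturality := fun hS hT f => nat (X := Span.kernelKite _) (Y := Span.kernelKite _)
             hS hT f.kernelKiteMap }⟩

/-! ### The directed kite of a reflexive graph -/

namespace RG

/-- The span part of a reflexive graph, reducibly. -/
abbrev span (R : RG C) : Span C := ⟨R.C₁, R.C₀, R.C₀, R.d, R.c, inferInstance, inferInstance⟩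

/-- The directed kite `C₁ ⇄ C₀ ⇄ C₁` of a reflexive graph, over its span part. -/
noncomputable abbrev kite (R : RG C) : DiKite C where
  A := R.C₁
  B := R.C₀
  C' := R.C₁
  span := R.span
  f := R.d
  r := R.e
  g := R.c
  s := R.e
  α := 𝟙 _
  β := R.e
  γ := 𝟙 _
  r_f := R.e_d
  s_g := R.e_c
  r_α := Category.comp_id _
  s_γ := Category.comp_id _
  α_d := by simp [R.e_d]
  γ_c := by simp [R.e_c]

/-- A multiplication on the kite of a reflexive graph is a unital multiplication. -/
noncomputable def umg (R : RG C) {m : pullback R.d R.c ⟶ R.C₁} (h : R.kite.IsMul m) : UMG C where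
  graph := R
  m := m
  m_d := h.comp_d.trans (congrArg _ (Category.id_comp _))
  m_c := h.comp_c.trans (congrArg _ (Category.id_comp _))
  e₁_m := h.e₁_comp
  e₂_m := h.e₂_comp

end RG

theorem UMG.isMul (X : UMG C) : X.graph.kite.IsMul X.m where
  comp_d := X.m_d.trans (congrArg _ (Category.id_comp _).symm)
  comp_c := X.m_c.trans (congrArg _ (Category.id_comp _).symm)
  e₁_comp := X.e₁_m
  e₂_comp := X.e₂_m

/-! ### Mal'tsev operations from multiplications on kernel graphs -/

namespace Span

instance (S : Span C) : HasPullback S.dom S.cod :=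
  inferInstanceAs (HasPullback S.kernelGraph.d S.kernelGraph.c)

theorem diag_dom (S : Span C) : S.diag ≫ S.dom = 𝟙 S.D := S.kernelGraph.e_d

theorem diag_cod (S : Span C) : S.diag ≫ S.cod = 𝟙 S.D := S.kernelGraph.e_c

/-- `(x, y, z) ↦ ((y, x, x), (z, z, y))`, a composable pair in the kernel graph. -/
noncomputable def toComposable (S : Span C) : S.triples ⟶ pullback S.dom S.cod :=
  pullback.lift (S.triple S.mid S.dom S.dom S.dom_d.symm rfl)
    (S.triple S.cod S.cod S.mid rfl S.mid_c.symm) (by simp)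

/-- A unital multiplication on the kernel graph induces a Mal'tsev operation on the span. -/
theorem isMaltsev_of_mul (S : Span C) (m : pullback S.dom S.cod ⟶ S.triples)
    (m_d : m ≫ S.dom = pullback.snd _ _ ≫ S.dom) (m_c : m ≫ S.cod = pullback.fst _ _ ≫ S.cod)
    (h₁ : pullback.lift (𝟙 _) (S.dom ≫ S.diag) (by simp [diag_cod]) ≫ m = 𝟙 _)
    (h₂ : pullback.lift (S.cod ≫ S.diag) (𝟙 _) (by simp [diag_dom]) ≫ m = 𝟙 _) :
    S.IsMaltsev (S.toComposable ≫ m ≫ S.mid) where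
  triple_left x y hxy := by
    -- The second factor is now the identity (y,y,y), so the product is (y,x,x), with middle entry
    -- x.
    have : S.triple x y y hxy rfl ≫ S.toComposable = S.triple y x x hxy.symm rfl ≫
        pullback.lift (𝟙 _) (S.dom ≫ S.diag) (by simp [diag_cod]) := by
      apply pullback.hom_ext <;> simp [toComposable, comp_triple, diag_eq_triple]
    rw [← Category.assoc, this, Category.assoc, ← Category.assoc _ m, h₁, Category.id_comp,
      triple_mid]
  triple_right y z hyz := by
    -- Here the first factor is an identity, and the product is (z,z,y).
    have : S.triple y y z rfl hyz ≫ S.toComposable = S.triple z z y rfl hyz.symm ≫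
        pullback.lift (S.cod ≫ S.diag) (𝟙 _) (by simp [diag_dom]) := by
      apply pullback.hom_ext <;> simp [toComposable, comp_triple, diag_eq_triple]
    rw [← Category.assoc, this, Category.assoc, ← Category.assoc _ m, h₂, Category.id_comp,
      triple_mid]
  comp_d := by
    -- The middle entry of the product has the same image under d as its first entry, which is z.
    simp only [Category.assoc, ← S.dom_d]
    simp [reassoc_of% m_d, toComposable, reassoc_of% triple_dom]
  comp_c := by
    simp only [Category.assoc, S.mid_c]
    simp [reassoc_of% m_c, toComposable, reassoc_of% triple_cod]

theorem Hom.toComposable_comp {S T : Span C} (f : Hom S T) :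
    S.toComposable ≫ pullback.map S.dom S.cod T.dom T.cod f.triplesMap f.triplesMap f.h
      f.triplesMap_dom.symm f.triplesMap_cod.symm = f.triplesMap ≫ T.toComposable := by
  apply pullback.hom_ext <;> simp [toComposable, comp_triple, triple_triplesMap]

/-- A multiplication that is compatible with a morphism of spans induces compatible Mal'tsev
operations. -/
theorem Hom.toComposable_mul_comp {S T : Span C} (f : Hom S T)
    (m : pullback S.dom S.cod ⟶ S.triples) (m' : pullback T.dom T.cod ⟶ T.triples)
    (h : m ≫ f.triplesMap = pullback.map S.dom S.cod T.dom T.cod f.triplesMap f.triplesMap f.h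
      f.triplesMap_dom.symm f.triplesMap_cod.symm ≫ m') :
    (S.toComposable ≫ m ≫ S.mid) ≫ f.h = f.triplesMap ≫ T.toComposable ≫ m' ≫ T.mid := by
  simp only [Category.assoc, ← f.triplesMap_mid]
  rw [← Category.assoc m, h, ← Category.assoc f.triplesMap, ← f.toComposable_comp]
  simp only [Category.assoc]

end Span

theorem nonempty_naturalMaltsev_of_umg {M : ObjectProperty (Span C)}
    (hK : ClosedUnderKernelPairs M) (h : HasSection (umgToRG M)) :
    Nonempty (NaturalMaltsev M) := by
  obtain ⟨G, hG, hn⟩ := HasSection.exists_lift h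
  have key : ∀ (R : RG C) (hR : M R.toSpan), ∃ m : pullback R.d R.c ⟶ R.C₁, R.kite.IsMul m ∧
      ((G R hR).m ≍ m) := by
    intro R hR
    have := (G R hR).isMul
    have e : (G R hR).graph = R := hG R hR
    revert e
    generalize G R hR = Y at *
    rintro rfl
    exact ⟨_, this, HEq.rfl⟩
  choose m hm hmG using key
  have nat : ∀ {X Y : RG C} (hX : M X.toSpan) (hY : M Y.toSpan) (f : RG.Hom X Y),
      m X hX ≫ f.f₁ = f.f₂ ≫ m Y hY := by
    intro X Y hX hY f
    obtain ⟨φ, hφ⟩ := hn X Y hX hY f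
    have eX : (G X hX).graph = X := hG X hX
    have eY : (G Y hY).graph = Y := hG Y hY
    have mX := hmG X hX
    have mY := hmG Y hY
    change φ.hom = eqToHom eX ≫ f ≫ eqToHom eY.symm at hφ
    generalize G X hX = X' at *
    generalize G Y hY = Y' at *
    generalize m X hX = q at *
    generalize m Y hY = q' at *
    subst eX eY
    obtain rfl := eq_of_heq mX
    obtain rfl := eq_of_heq mY
    simp only [eqToHom_refl, Category.comp_id, Category.id_comp] at hφ
    subst hφ
    exact φ.w_m
  exact ⟨{ p := fun S hS => S.toComposable ≫ (m S.kernelGraph (hK S hS) : _ ⟶ S.triples) ≫ S.mid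
           isMaltsev := fun S hS =>
             let X := S.kernelGraph.umg (hm _ (hK S hS))
             S.isMaltsev_of_mul _ X.m_d X.m_c X.e₁_m X.e₂_m
           naturality := fun {S T} hS hT f => f.toComposable_mul_comp _ _
             (nat (hK S hS) (hK T hT) f.kernelGraphMap) }⟩

variable {M : ObjectProperty (Span C)}

/-! ### The Kite Condition from natural Mal'tsev operations -/

namespace Span

theorem triple_congr (S : Span C) {Z : C} {x y z x' y' z' : Z ⟶ S.D} (hx : x = x') (hy : y = y')
    (hz : z = z') (h : x ≫ S.d = y ≫ S.d) (h' : y ≫ S.c = z ≫ S.c) :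
    S.triple x y z h h' =
      S.triple x' y' z' (by rw [← hx, ← hy, h]) (by rw [← hy, ← hz, h']) := by
  subst hx hy hz
  rfl

/-- The span with its legs interchanged. -/
abbrev op (S : Span C) : Span C where
  D := S.D
  D₀ := S.D₁
  D₁ := S.D₀
  d := S.c
  c := S.d
  hasKernelPair_d := S.hasKernelPair_c
  hasKernelPair_c := S.hasKernelPair_d

theorem e₁_p₁ (S : Span C) : S.e₁ ≫ S.p₁ = 𝟙 _ := by simp [e₁, p₁]

theorem e₂_p₂ (S : Span C) : S.e₂ ≫ S.p₂ = 𝟙 _ := by simp [e₂, p₂]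

theorem e₁_p₂ (S : Span C) :
    S.e₁ ≫ S.p₂ = pullback.snd S.d S.d ≫ pullback.lift (𝟙 _) (𝟙 _) rfl := by simp [e₁, p₂]

theorem e₂_p₁ (S : Span C) :
    S.e₂ ≫ S.p₁ = pullback.fst S.c S.c ≫ pullback.lift (𝟙 _) (𝟙 _) rfl := by simp [e₂, p₁]

/-- The local product `D(d) ×_D D(c)`, as a span from `D(c)` to `D(d)`. -/
noncomputable abbrev triplesSpan (S : Span C) : Span C where
  D := S.triples
  D₀ := pullback S.c S.c
  D₁ := pullback S.d S.d
  d := S.p₂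
  c := S.p₁
  hasKernelPair_d := HasLocalProducts.hasPullback _ S.e₂ _ S.e₂ S.e₂_p₂ S.e₂_p₂
  hasKernelPair_c := HasLocalProducts.hasPullback _ S.e₁ _ S.e₁ S.e₁_p₁ S.e₁_p₁

/-- Local products are symmetric: exchanging the two split epimorphisms reverses the legs. The
reversed direction is the one needed in `hom_op_eq_triple`. -/
theorem triplesSpan_mem (hL : ContainsLocalProducts M) (S : Span C) : M S.triplesSpan :=
  hL S.triplesSpan S.e₂ S.e₁
    ⟨S.D, pullback.fst _ _, pullback.lift (𝟙 _) (𝟙 _) rfl, pullback.snd _ _,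
      pullback.lift (𝟙 _) (𝟙 _) rfl, by simp, by simp, (IsPullback.of_hasPullback _ _).flip,
      S.e₂_p₂, S.e₂_p₁, S.e₁_p₂, S.e₁_p₁⟩

theorem triplesSpan_jointlyMonic (S : Span C) : S.triplesSpan.JointlyMonic :=
  fun _ _ _ h h' => pullback.hom_ext h' h

theorem p₁_e₁ (S : Span C) : S.p₁ ≫ S.e₁ = S.triple S.dom S.mid S.mid S.dom_d rfl := by
  rw [e₁_eq_triple, comp_triple]; rfl

theorem p₂_e₂ (S : Span C) : S.p₂ ≫ S.e₂ = S.triple S.mid S.mid S.cod rfl S.mid_c := by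
  rw [e₂_eq_triple, comp_triple]
  exact S.triple_congr S.p₂_fst S.p₂_fst rfl _ _

end Span

namespace NaturalMaltsev

variable (P : NaturalMaltsev M)
include P

/-- A morphism out of a relation in `M` with commuting idempotents `a` and `b` fixing its legs is
determined by its composites with `a` and `b`. -/
theorem hom_eq_triple {S T : Span C} (hS : M S) (hT : M T) (hj : T.JointlyMonic)
    {a b : T.D ⟶ T.D} (hab : b ≫ a = a ≫ b) (ha : a ≫ T.c = T.c) (hb : b ≫ T.d = T.d)
    (f : Span.Hom T S) (h : (a ≫ f.h) ≫ S.d = (b ≫ a ≫ f.h) ≫ S.d)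
    (h' : (b ≫ a ≫ f.h) ≫ S.c = (b ≫ f.h) ≫ S.c) :
    f.h = S.triple (a ≫ f.h) (b ≫ a ≫ f.h) (b ≫ f.h) h h' ≫ P.p S hS := by
  have h₁ : a ≫ T.d = (b ≫ a) ≫ T.d := by rw [hab, Category.assoc, hb]
  have h₂ : (b ≫ a) ≫ T.c = b ≫ T.c := by rw [Category.assoc, ha]
  -- The legs of p(a, ab, b) are those of b under d and of a under c, hence those of the identity.
  -- Naturality along f then gives the formula.
  have key : T.triple a (b ≫ a) b h₁ h₂ ≫ P.p T hT = 𝟙 _ := by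
    apply hj
    · rw [(P.isMaltsev T hT).triple_comp_d, hb, Category.id_comp]
    · rw [(P.isMaltsev T hT).triple_comp_c, ha, Category.id_comp]
  have := P.triple_comp hT hS f a (b ≫ a) b h₁ h₂
  rw [← Category.assoc, key, Category.id_comp] at this
  simpa using this

/-- As `hom_eq_triple`, for a morphism from the opposite of a relation in `M`. -/
theorem hom_op_eq_triple (hL : ContainsLocalProducts M) {S T : Span C} (hS : M S) (hT : M T)
    (hj : T.JointlyMonic) {a b : T.D ⟶ T.D} (hab : b ≫ a = a ≫ b) (ha : a ≫ T.d = T.d)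
    (hb : b ≫ T.c = T.c) {m : T.D ⟶ S.D} {k₀ : T.D₁ ⟶ S.D₀} {k₁ : T.D₀ ⟶ S.D₁}
    (hd : m ≫ S.d = T.c ≫ k₀) (hc : m ≫ S.c = T.d ≫ k₁)
    (h : (a ≫ m) ≫ S.d = (b ≫ a ≫ m) ≫ S.d) (h' : (b ≫ a ≫ m) ≫ S.c = (b ≫ m) ≫ S.c) :
    m = S.triple (a ≫ m) (b ≫ a ≫ m) (b ≫ m) h h' ≫ P.p S hS := by
  have hp := P.isMaltsev T hT
  -- `q (x, y, z) = p (z, y, x)`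
  let q : T.op.triples ⟶ T.D :=
    T.triple T.op.cod T.op.mid T.op.dom T.op.mid_c.symm T.op.dom_d.symm ≫ P.p T hT
  have q_triple : ∀ {Z : C} (x y z : Z ⟶ T.D) (h : x ≫ T.c = y ≫ T.c) (h' : y ≫ T.d = z ≫ T.d),
      T.op.triple x y z h h' ≫ q = T.triple z y x h'.symm h.symm ≫ P.p T hT := by
    intro Z x y z h h'
    simp only [q]
    rw [← Category.assoc, Span.comp_triple]
    congr 1
    exact T.triple_congr (T.op.triple_cod _ _ _ _ _) (T.op.triple_mid _ _ _ _ _)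
      (T.op.triple_dom _ _ _ _ _) _ _
  have q_d : q ≫ T.d = T.op.dom ≫ T.d := hp.triple_comp_d _ _ _ _ _
  have q_c : q ≫ T.c = T.op.cod ≫ T.c := hp.triple_comp_c _ _ _ _ _
  -- Under c, q(x,y,z) depends only on z, and under d only on x. So q followed by m respects the
  -- reversed legs of the local product, although m alone starts from a span not known to be in `M`.
  let f : Span.Hom T.op.triplesSpan S :=
    { h := q ≫ m
      h₀ := pullback.snd T.d T.d ≫ T.c ≫ k₀
      h₁ := pullback.fst T.c T.c ≫ T.d ≫ k₁
      w_d := by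
        rw [Category.assoc, hd, ← Category.assoc, q_c, Category.assoc]
        exact Category.assoc _ _ _
      w_c := by
        rw [Category.assoc, hc, ← Category.assoc, q_d, Category.assoc]
        exact Category.assoc _ _ _ }
  have e_a : (T.op.p₁ ≫ T.op.e₁) ≫ q = T.op.dom := by
    rw [Span.p₁_e₁, q_triple, hp.triple_right]
  have e_b : (T.op.p₂ ≫ T.op.e₂) ≫ q = T.op.cod := by
    rw [Span.p₂_e₂, q_triple, hp.triple_left]
  have b_a : (T.op.p₂ ≫ T.op.e₂) ≫ T.op.p₁ ≫ T.op.e₁ =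
      T.op.triple T.op.mid T.op.mid T.op.mid rfl rfl := by
    rw [Span.p₂_e₂, Span.p₁_e₁, Span.comp_triple]
    exact T.op.triple_congr (by simp) (by simp) (by simp) _ _
  have a_b : (T.op.p₁ ≫ T.op.e₁) ≫ T.op.p₂ ≫ T.op.e₂ =
      T.op.triple T.op.mid T.op.mid T.op.mid rfl rfl := by
    rw [Span.p₂_e₂, Span.p₁_e₁, Span.comp_triple]
    exact T.op.triple_congr (by simp) (by simp) (by simp) _ _
  have e_ba : (T.op.p₂ ≫ T.op.e₂) ≫ (T.op.p₁ ≫ T.op.e₁) ≫ q = T.op.mid := by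
    rw [← Category.assoc, b_a, q_triple, hp.triple_right]
  have f_a : (T.op.p₁ ≫ T.op.e₁) ≫ f.h = T.op.dom ≫ m := by
    simp only [f]; rw [← Category.assoc, e_a]
  have f_b : (T.op.p₂ ≫ T.op.e₂) ≫ f.h = T.op.cod ≫ m := by
    simp only [f]; rw [← Category.assoc, e_b]
  have f_ba : (T.op.p₂ ≫ T.op.e₂) ≫ (T.op.p₁ ≫ T.op.e₁) ≫ f.h = T.op.mid ≫ m := by
    rw [f_a, ← e_ba, ← e_a]; simp only [Category.assoc]
  have m_d : (T.op.dom ≫ m) ≫ S.d = (T.op.mid ≫ m) ≫ S.d := by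
    simp only [Category.assoc, hd]
    rw [reassoc_of% T.op.dom_d]
  have m_c : (T.op.mid ≫ m) ≫ S.c = (T.op.cod ≫ m) ≫ S.c := by
    simp only [Category.assoc, hc]
    rw [reassoc_of% T.op.mid_c]
  -- The two idempotents of the local product send (x,y,z) to (x,y,y) and (y,y,z), where q takes the
  -- values x and z; their composite gives (y,y,y), with value y. Hence m carries q to p.
  have key : q ≫ m =
      S.triple (T.op.dom ≫ m) (T.op.mid ≫ m) (T.op.cod ≫ m) m_d m_c ≫ P.p S hS := by
    have := P.hom_eq_triple hS (T.op.triplesSpan_mem hL) T.op.triplesSpan_jointlyMonic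
      (a := T.op.p₁ ≫ T.op.e₁) (b := T.op.p₂ ≫ T.op.e₂) (b_a.trans a_b.symm)
      (by
        change (T.op.p₁ ≫ T.op.e₁) ≫ T.op.p₁ = T.op.p₁
        rw [Category.assoc, Span.e₁_p₁, Category.comp_id])
      (by
        change (T.op.p₂ ≫ T.op.e₂) ≫ T.op.p₂ = T.op.p₂
        rw [Category.assoc, Span.e₂_p₂, Category.comp_id])
      f (by rw [f_ba, f_a, m_d]) (by rw [f_ba, f_b, m_c])
    refine this.trans ?_
    congr 1
    exact S.triple_congr f_a f_ba f_b _ _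
  have h₁ : a ≫ T.c = (b ≫ a) ≫ T.c := by rw [hab, Category.assoc, hb]
  have h₂ : (b ≫ a) ≫ T.d = b ≫ T.d := by rw [Category.assoc, ha]
  -- As `T` is a relation, q(a, ab, b) is the identity; substituting this triple into `key` recovers
  -- m.
  have t_q : T.op.triple a (b ≫ a) b h₁ h₂ ≫ q = 𝟙 _ := by
    apply hj
    · rw [q_triple, hp.triple_comp_d, ha, Category.id_comp]
    · rw [q_triple, hp.triple_comp_c, hb, Category.id_comp]
  have := congrArg (T.op.triple a (b ≫ a) b h₁ h₂ ≫ ·) key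
  simp only at this
  rw [← Category.assoc, t_q, Category.id_comp, ← Category.assoc, Span.comp_triple] at this
  refine this.trans ?_
  congr 1
  refine S.triple_congr ?_ ?_ ?_ _ _
  · rw [← Category.assoc]; exact congrArg (· ≫ m) (T.op.triple_dom _ _ _ _ _)
  · rw [← Category.assoc, ← Category.assoc]; exact congrArg (· ≫ m) (T.op.triple_mid _ _ _ _ _)
  · rw [← Category.assoc]; exact congrArg (· ≫ m) (T.op.triple_cod _ _ _ _ _)

theorem kiteCondition (hL : ContainsLocalProducts M) : KiteCondition M := by
  intro S T hS hT hj e₁ e₂ α β γ h₁ h₂ hcomm hα hγ hd hc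
  have hp := P.isMaltsev S hS
  have hd' : (T.d ≫ α) ≫ S.d = β ≫ S.d := by rw [← hα, Category.assoc, Category.assoc, hd]
  have hc' : β ≫ S.c = (T.c ≫ γ) ≫ S.c := by rw [Category.assoc, hc, ← hγ, Category.assoc _ γ]
  have e₁_β : e₁ ≫ β = e₁ ≫ T.c ≫ γ := by
    rw [← hγ]; simp only [Category.assoc, reassoc_of% h₁]
  have e₂_β : e₂ ≫ β = e₂ ≫ T.d ≫ α := by
    rw [← hα]; simp only [Category.assoc, reassoc_of% h₂]
  -- Along e₁ the last two entries coincide, and along e₂ the first two, so the Mal'tsev identities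
  -- give α and γ.
  refine ⟨S.triple (T.d ≫ α) β (T.c ≫ γ) hd' hc' ≫ P.p S hS, ⟨?_, ?_, ?_, ?_⟩, ?_⟩
  · rw [← Category.assoc, Span.comp_triple,
      S.triple_congr (by rw [reassoc_of% h₁]) e₁_β rfl _ _, hp.triple_left]
  · rw [← Category.assoc, Span.comp_triple,
      S.triple_congr rfl e₂_β (by rw [reassoc_of% h₂]) _ _, hp.triple_right]
  · rw [hp.triple_comp_d, Category.assoc]
  · rw [hp.triple_comp_c, Category.assoc]
  · rintro m ⟨m₁, m₂, m_d, m_c⟩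
    have ha : (T.d ≫ e₁) ≫ m = T.d ≫ α := by rw [Category.assoc, m₁]
    have hb : (T.c ≫ e₂) ≫ m = T.c ≫ γ := by rw [Category.assoc, m₂]
    have hba : (T.c ≫ e₂) ≫ (T.d ≫ e₁) ≫ m = β := by rw [ha, ← hα]; simp only [Category.assoc]
    rw [P.hom_op_eq_triple hL hS hT hj (a := T.d ≫ e₁) (b := T.c ≫ e₂) hcomm
      (by rw [Category.assoc, h₁, Category.comp_id]) (by rw [Category.assoc, h₂, Category.comp_id])
      m_d m_c (by rw [hba, ha, hd']) (by rw [hba, hb, hc'])]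
    congr 1
    exact S.triple_congr ha hba hb _ _

end NaturalMaltsev

/-! ### Multiplications from the Kite Condition -/

namespace DiKite

theorem e₁_fst (X : DiKite C) : X.e₁ ≫ pullback.fst X.f X.g = 𝟙 _ := by simp [e₁]

theorem e₁_snd (X : DiKite C) : X.e₁ ≫ pullback.snd X.f X.g = X.f ≫ X.s := by simp [e₁]

theorem e₂_fst (X : DiKite C) : X.e₂ ≫ pullback.fst X.f X.g = X.g ≫ X.r := by simp [e₂]

theorem e₂_snd (X : DiKite C) : X.e₂ ≫ pullback.snd X.f X.g = 𝟙 _ := by simp [e₂]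

/-- The local product of a directed kite, as a span. -/
noncomputable abbrev localSpan (X : DiKite C) : Span C where
  D := pullback X.f X.g
  D₀ := X.A
  D₁ := X.C'
  d := pullback.fst _ _
  c := pullback.snd _ _
  hasKernelPair_d := HasLocalProducts.hasPullback _ X.e₁ _ X.e₁ X.e₁_fst X.e₁_fst
  hasKernelPair_c := HasLocalProducts.hasPullback _ X.e₂ _ X.e₂ X.e₂_snd X.e₂_snd

theorem localSpan_mem (hL : ContainsLocalProducts M) (X : DiKite C) : M X.localSpan :=
  hL X.localSpan X.e₁ X.e₂ ⟨X.B, X.f, X.r, X.g, X.s, X.r_f, X.s_g, IsPullback.of_hasPullback _ _,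
    X.e₁_fst, X.e₁_snd, X.e₂_fst, X.e₂_snd⟩

end DiKite

/-- The local product A ×_B C' is a relation in `M`; both composites of its idempotents are ⟨r, s⟩
applied to the common image in B. The Kite Condition thus applies with β precomposed by the map to
B. -/
theorem KiteCondition.existsUnique_isMul (h : KiteCondition M) (hL : ContainsLocalProducts M)
    (X : DiKite C) (hX : M X.span) : ∃! m, X.IsMul m := by
  have key := h X.span X.localSpan hX (X.localSpan_mem hL)
    (fun _ _ _ h h' => pullback.hom_ext h h') X.e₁ X.e₂ X.α
    (pullback.snd X.f X.g ≫ X.g ≫ X.β) X.γ X.e₁_fst X.e₂_snd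
    (by
      apply pullback.hom_ext
      · simp [DiKite.e₁, DiKite.e₂, pullback.condition_assoc, reassoc_of% X.s_g]
      · simp [DiKite.e₁, DiKite.e₂, pullback.condition_assoc, reassoc_of% X.r_f])
    (by simp [reassoc_of% X.e₂_fst, X.r_α])
    (by simp [reassoc_of% X.e₁_snd, X.s_γ, pullback.condition_assoc])
    (by
      simp only [Category.assoc, X.α_d]
      rw [reassoc_of% X.e₂_fst, reassoc_of% X.r_f, pullback.condition_assoc])
    (by simp [reassoc_of% X.e₁_snd, X.γ_c, reassoc_of% X.s_g, pullback.condition_assoc])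
  obtain ⟨m, ⟨h₁, h₂, hd, hc⟩, hu⟩ := key
  exact ⟨m, ⟨hd, hc, h₁, h₂⟩,
    fun m' h' => hu m' ⟨h'.e₁_comp, h'.e₂_comp, h'.comp_d, h'.comp_c⟩⟩

/-! ### Naturality and bijectivity from unique multiplications -/

namespace DiKite

/-- The directed kite obtained by composing with a morphism of spans. -/
abbrev along (X : DiKite C) {T : Span C} (k : Span.Hom X.span T) : DiKite C where
  A := X.A
  B := X.B
  C' := X.C'
  span := T
  f := X.f
  r := X.r
  g := X.g
  s := X.s
  α := X.α ≫ k.h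
  β := X.β ≫ k.h
  γ := X.γ ≫ k.h
  r_f := X.r_f
  s_g := X.s_g
  r_α := by rw [← Category.assoc, X.r_α]
  s_γ := by rw [← Category.assoc, X.s_γ]
  α_d := by simp [k.w_d, reassoc_of% X.α_d]
  γ_c := by simp [k.w_c, reassoc_of% X.γ_c]

theorem IsMul.along {X : DiKite C} {m : pullback X.f X.g ⟶ X.span.D} (h : X.IsMul m)
    {T : Span C} (k : Span.Hom X.span T) : (X.along k).IsMul (m ≫ k.h) where
  comp_d := by simp [k.w_d, reassoc_of% h.comp_d]
  comp_c := by simp [k.w_c, reassoc_of% h.comp_c]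
  e₁_comp := by
    change X.e₁ ≫ m ≫ k.h = X.α ≫ k.h
    rw [← Category.assoc, h.e₁_comp]
  e₂_comp := by
    change X.e₂ ≫ m ≫ k.h = X.γ ≫ k.h
    rw [← Category.assoc, h.e₂_comp]

theorem Hom.e₁_pullbackMap {X Y : DiKite C} (f : Hom X Y) :
    X.e₁ ≫ f.pullbackMap = f.hA ≫ Y.e₁ := by
  apply pullback.hom_ext <;> simp [e₁, pullbackMap, reassoc_of% f.w_f, f.w_s]

theorem Hom.e₂_pullbackMap {X Y : DiKite C} (f : Hom X Y) :
    X.e₂ ≫ f.pullbackMap = f.hC ≫ Y.e₂ := by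
  apply pullback.hom_ext <;> simp [e₂, pullbackMap, reassoc_of% f.w_g, f.w_r]

theorem IsMul.pullbackMap_comp {X Y : DiKite C} {m : pullback Y.f Y.g ⟶ Y.span.D} (h : Y.IsMul m)
    (f : Hom X Y) : (X.along f.hom).IsMul (f.pullbackMap ≫ m) where
  comp_d := by simp [h.comp_d, Hom.pullbackMap, reassoc_of% f.w_γ]
  comp_c := by simp [h.comp_c, Hom.pullbackMap, reassoc_of% f.w_α]
  e₁_comp := by
    change X.e₁ ≫ f.pullbackMap ≫ m = X.α ≫ f.hom.h
    rw [← Category.assoc, f.e₁_pullbackMap, Category.assoc, h.e₁_comp, f.w_α]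
  e₂_comp := by
    change X.e₂ ≫ f.pullbackMap ≫ m = X.γ ≫ f.hom.h
    rw [← Category.assoc, f.e₂_pullbackMap, Category.assoc, h.e₂_comp, f.w_γ]

end DiKite

/-- Every directed kite over a span in `M` has exactly one multiplication. -/
def UniqueMul (M : ObjectProperty (Span C)) : Prop := ∀ X : DiKite C, M X.span → ∃! m, X.IsMul m

namespace UniqueMul

variable (h : UniqueMul M)
include h

/-- Both sides are multiplications on the kite of `X` pushed forward along its span morphism to the
span of `Y`, so uniqueness over that span identifies them. -/
theorem naturality {X Y : DiKite C} {m : pullback X.f X.g ⟶ X.span.D}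
    {m' : pullback Y.f Y.g ⟶ Y.span.D} (hm : X.IsMul m) (hm' : Y.IsMul m') (hY : M Y.span)
    (f : DiKite.Hom X Y) : m ≫ f.hom.h = f.pullbackMap ≫ m' :=
  (h (X.along f.hom) hY).unique (hm.along f.hom) (hm'.pullbackMap_comp f)

theorem mKite_bijectiveOver :
    BijectiveOver (MKite.forget C) (M.inverseImage (DiKite.spanFunctor C)) where
  faithful := ⟨fun {_ _} _ _ hab => MKite.Hom.ext hab⟩
  full {X Y} _ hY f := ⟨⟨f, h.naturality X.isMul Y.isMul hY f⟩, rfl⟩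
  existsUnique X hX := by
    obtain ⟨m, hm, hu⟩ := h X hX
    refine ⟨⟨X, m, hm.comp_d, hm.comp_c, hm.e₁_comp, hm.e₂_comp⟩, rfl, ?_⟩
    rintro Y rfl
    cases hu Y.m Y.isMul
    rfl

theorem preGrpd_bijectiveOver : BijectiveOver (PreGrpd.forget C) M where
  faithful := ⟨fun {_ _} _ _ hab => PreGrpd.Hom.ext hab⟩
  full {X Y} _ hY f := ⟨⟨f, h.naturality (X := X.span.kernelKite) (Y := Y.span.kernelKite)
    ((Span.kernelKite_isMul_iff _ _).2 X.isMaltsev)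
    ((Span.kernelKite_isMul_iff _ _).2 Y.isMaltsev) hY (Span.Hom.kernelKiteMap f)⟩, rfl⟩
  existsUnique S hS := by
    obtain ⟨p, hp, hu⟩ := h S.kernelKite hS
    refine ⟨((S.kernelKite_isMul_iff p).1 hp).preGrpd, rfl, ?_⟩
    rintro Y rfl
    cases hu Y.p ((Y.span.kernelKite_isMul_iff _).2 Y.isMaltsev)
    rfl

end UniqueMul

/-- The morphism of directed kites induced by a morphism of reflexive graphs. -/
noncomputable abbrev RG.Hom.kiteMap {X Y : RG C} (f : RG.Hom X Y) : DiKite.Hom X.kite Y.kite where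
  hA := f.f₁
  hB := f.f₀
  hC := f.f₁
  hom := ⟨f.f₁, f.f₀, f.f₀, f.w_d, f.w_c⟩
  w_f := f.w_d
  w_r := f.w_e.symm
  w_g := f.w_c
  w_s := f.w_e.symm
  w_α := by simp
  w_β := f.w_e.symm
  w_γ := by simp

theorem UniqueMul.umg_bijectiveOver (h : UniqueMul M) :
    BijectiveOver (UMG.forget C) (M.inverseImage (RG.spanFunctor C)) where
  faithful := ⟨fun {_ _} _ _ hab => UMG.Hom.ext hab⟩
  full {X Y} _ hY f := ⟨⟨f, h.naturality X.isMul Y.isMul hY (RG.Hom.kiteMap f)⟩, rfl⟩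
  existsUnique R hR := by
    obtain ⟨m, hm, hu⟩ := h R.kite hR
    refine ⟨R.umg hm, rfl, ?_⟩
    rintro Y rfl
    cases hu Y.m Y.isMul
    rfl

/-! ### Associativity and inverses -/

namespace UMG

variable (X : UMG C)

theorem comp_mul {Z W : C} (a : W ⟶ Z) (x y : Z ⟶ X.graph.C₁)
    (h : x ≫ X.graph.d = y ≫ X.graph.c) :
    a ≫ X.mul x y h = X.mul (a ≫ x) (a ≫ y) (by simp [h]) := by
  rw [mul, mul, ← Category.assoc]
  congr 1
  apply pullback.hom_ext <;> simp

theorem mul_congr {Z : C} {x y x' y' : Z ⟶ X.graph.C₁} (hx : x = x') (hy : y = y')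
    (h : x ≫ X.graph.d = y ≫ X.graph.c) : X.mul x y h = X.mul x' y' (by rw [← hx, ← hy, h]) := by
  subst hx hy
  rfl

theorem mul_one {Z : C} (x : Z ⟶ X.graph.C₁) :
    X.mul x (x ≫ X.graph.d ≫ X.graph.e) (by simp [X.graph.e_c]) = x := by
  have : pullback.lift x (x ≫ X.graph.d ≫ X.graph.e) (by simp [X.graph.e_c]) = x ≫ X.graph.e₁ := by
    apply pullback.hom_ext <;> simp [RG.e₁]
  rw [mul, this, Category.assoc, X.e₁_m, Category.comp_id]

theorem one_mul {Z : C} (x : Z ⟶ X.graph.C₁) :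
    X.mul (x ≫ X.graph.c ≫ X.graph.e) x (by simp [X.graph.e_d]) = x := by
  have : pullback.lift (x ≫ X.graph.c ≫ X.graph.e) x (by simp [X.graph.e_d]) = x ≫ X.graph.e₂ := by
    apply pullback.hom_ext <;> simp [RG.e₂]
  rw [mul, this, Category.assoc, X.e₂_m, Category.comp_id]

theorem mul_fst_snd : X.mul (pullback.fst _ _) (pullback.snd _ _) pullback.condition = X.m := by
  have : pullback.lift (pullback.fst X.graph.d X.graph.c) (pullback.snd _ _) pullback.condition =
      𝟙 _ := by
    apply pullback.hom_ext <;> simp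
  rw [mul, this, Category.id_comp]

/-- The object of composable triples is itself a local product, split by y ↦ (1,y) and y ↦ (y,1). -/
instance (R : RG C) : HasPullback (pullback.snd R.d R.c) (pullback.fst R.d R.c) :=
  HasLocalProducts.hasPullback _ R.e₂ _ R.e₁ (by simp [RG.e₂]) (by simp [RG.e₁])

/-- The directed kite `C₂ ⇄ C₁ ⇄ C₂` whose multiplications are the ways of composing three arrows
compatibly with `m`. -/
noncomputable abbrev assocKite : DiKite C where
  A := pullback X.graph.d X.graph.c
  B := X.graph.C₁
  C' := pullback X.graph.d X.graph.c
  span := X.graph.span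
  f := pullback.snd _ _
  r := X.graph.e₂
  g := pullback.fst _ _
  s := X.graph.e₁
  α := X.m
  β := 𝟙 _
  γ := X.m
  r_f := by simp [RG.e₂]
  s_g := by simp [RG.e₁]
  r_α := X.e₂_m
  s_γ := X.e₁_m
  α_d := by simp [X.m_d]
  γ_c := by simp [X.m_c]

/-- This is (xy)z. On ((x,y),(y,1)) and ((1,y),(y,z)) the unit laws reduce it to xy and yz. -/
theorem isMul_mul_left : X.assocKite.IsMul
    (X.mul (pullback.fst X.assocKite.f X.assocKite.g ≫ X.m)
      (pullback.snd X.assocKite.f X.assocKite.g ≫ pullback.snd _ _)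
      (by simp only [Category.assoc, X.m_d, ← pullback.condition]
          exact pullback.condition_assoc _)) where
  comp_d := by simp only [mul_d, Category.assoc, X.m_d]
  comp_c := by simp only [mul_c, Category.assoc]
  e₁_comp := by
    rw [comp_mul]
    refine (X.mul_congr (x' := X.m) (y' := X.m ≫ X.graph.d ≫ X.graph.e) ?_ ?_ _).trans
      (X.mul_one _)
    · rw [reassoc_of% X.assocKite.e₁_fst]
    · rw [reassoc_of% X.assocKite.e₁_snd, reassoc_of% X.m_d]
      simp [RG.e₁]
  e₂_comp := by
    rw [comp_mul]
    refine (X.mul_congr ?_ ?_ _).trans X.mul_fst_snd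
    · rw [reassoc_of% X.assocKite.e₂_fst, X.e₂_m, Category.comp_id]
    · rw [reassoc_of% X.assocKite.e₂_snd]

/-- The other bracketing x(yz) has the same boundary values, so uniqueness will give associativity.
-/
theorem isMul_mul_right : X.assocKite.IsMul
    (X.mul (pullback.fst X.assocKite.f X.assocKite.g ≫ pullback.fst _ _)
      (pullback.snd X.assocKite.f X.assocKite.g ≫ X.m)
      (by simp only [Category.assoc, X.m_c, pullback.condition]
          exact pullback.condition_assoc _)) where
  comp_d := by simp only [mul_d, Category.assoc]
  comp_c := by simp only [mul_c, Category.assoc, X.m_c]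
  e₁_comp := by
    rw [comp_mul]
    refine (X.mul_congr ?_ ?_ _).trans X.mul_fst_snd
    · rw [reassoc_of% X.assocKite.e₁_fst]
    · rw [reassoc_of% X.assocKite.e₁_snd, X.e₁_m, Category.comp_id]
  e₂_comp := by
    rw [comp_mul]
    refine (X.mul_congr (x' := X.m ≫ X.graph.c ≫ X.graph.e) (y' := X.m) ?_ ?_ _).trans
      (X.one_mul _)
    · rw [reassoc_of% X.assocKite.e₂_fst, reassoc_of% X.m_c]
      simp [RG.e₂]
    · rw [reassoc_of% X.assocKite.e₂_snd]

variable {X}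

theorem isAssociative_of_uniqueMul (h : UniqueMul M) (hX : M X.graph.toSpan) :
    X.IsAssociative := by
  intro Z x y z hxy hyz
  have key := (h X.assocKite hX).unique X.isMul_mul_left X.isMul_mul_right
  let t : Z ⟶ pullback X.assocKite.f X.assocKite.g :=
    pullback.lift (pullback.lift x y hxy) (pullback.lift y z hyz) (by simp)
  have := congrArg (t ≫ ·) key
  dsimp only at this
  rw [comp_mul, comp_mul] at this
  refine Eq.trans ?_ (this.trans ?_)
  · exact X.mul_congr (by simp [t, mul]) (by simp [t]) _
  · exact X.mul_congr (by simp [t]) (by simp [t, mul]) _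

/-- The directed kite `D(d) ⇄ C₁ ⇄ D(c)` with left splitting `v ↦ (1, v)`, whose multiplications
are the operations `(x, v, w) ↦ x v⁻¹ w`. -/
noncomputable abbrev divisionKite (R : RG C) {p : R.span.triples ⟶ R.span.D}
    (hp : R.span.IsMaltsev p) : DiKite C where
  A := pullback R.d R.d
  B := R.C₁
  C' := pullback R.c R.c
  span := R.span
  f := pullback.snd _ _
  r := pullback.lift (R.d ≫ R.e) (𝟙 _) (by simp [R.e_d])
  g := pullback.fst _ _
  s := pullback.lift (𝟙 _) (𝟙 _) rfl
  α := pullback.fst _ _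
  β := R.d ≫ R.e
  γ := R.span.triple (pullback.fst _ _ ≫ R.d ≫ R.e) (pullback.fst _ _) (pullback.snd _ _)
    (by simp [R.e_d]) pullback.condition ≫ p
  r_f := by simp
  s_g := by simp
  r_α := by simp
  s_γ := by
    rw [← Category.assoc, Span.comp_triple,
      R.span.triple_congr (x' := R.d ≫ R.e) (y' := 𝟙 _) (z' := 𝟙 _) (by simp) (by simp) (by simp),
      hp.triple_left]
  α_d := by simp [R.e_d, pullback.condition]
  γ_c := by
    rw [hp.triple_comp_c]
    simp

theorem divisionKite_e₁ (R : RG C) {p : R.span.triples ⟶ R.span.D} (hp : R.span.IsMaltsev p) :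
    (divisionKite R hp).e₁ = R.span.triple (pullback.fst _ _) (pullback.snd _ _) (pullback.snd _ _)
      pullback.condition rfl :=
  R.span.e₁_eq_triple

theorem divisionKite_e₂ (R : RG C) {p : R.span.triples ⟶ R.span.D} (hp : R.span.IsMaltsev p) :
    (divisionKite R hp).e₂ = R.span.triple (pullback.fst _ _ ≫ R.d ≫ R.e) (pullback.fst _ _)
      (pullback.snd _ _) (by simp [R.e_d]) pullback.condition := by
  refine Span.triples_ext (S := R.span) ?_ ?_ ?_ <;>
    simp [DiKite.e₂, Span.dom, Span.mid, Span.cod, Span.p₁, Span.p₂, Span.triple]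

theorem isMul_maltsev (R : RG C) {p : R.span.triples ⟶ R.span.D} (hp : R.span.IsMaltsev p) :
    (divisionKite R hp).IsMul p where
  comp_d := by
    rw [hp.comp_d, hp.triple_comp_d]
    exact Category.assoc _ _ _
  comp_c := by
    rw [hp.comp_c]
    exact Category.assoc _ _ _
  e₁_comp := by rw [divisionKite_e₁, hp.triple_left]
  e₂_comp := by rw [divisionKite_e₂]

/-- The operation `(x, v, w) ↦ x p(1, v, w)` is the Mal'tsev operation. -/
theorem isMul_mul_maltsev {p : X.graph.span.triples ⟶ X.graph.span.D}
    (hp : X.graph.span.IsMaltsev p) : (divisionKite X.graph hp).IsMul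
      (X.mul X.graph.span.dom (X.graph.span.triple (X.graph.span.mid ≫ X.graph.d ≫ X.graph.e)
        X.graph.span.mid X.graph.span.cod (by simp [X.graph.e_d]) X.graph.span.mid_c ≫ p)
        (by
          rw [hp.triple_comp_c]
          simp [X.graph.e_c, X.graph.span.dom_d])) where
  comp_d := by
    rw [mul_d, hp.triple_comp_d, hp.triple_comp_d]
    exact Category.assoc _ _ _
  comp_c := by
    rw [mul_c]
    exact Category.assoc _ _ _
  e₁_comp := by
    rw [comp_mul, divisionKite_e₁]
    refine (X.mul_congr (x' := pullback.fst _ _)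
      (y' := pullback.fst _ _ ≫ X.graph.d ≫ X.graph.e) ?_ ?_ _).trans (X.mul_one _)
    · simp
    · rw [← Category.assoc, Span.comp_triple, X.graph.span.triple_congr
        (x' := pullback.snd _ _ ≫ X.graph.d ≫ X.graph.e) (y' := pullback.snd _ _)
        (z' := pullback.snd _ _) (by rw [← Category.assoc, Span.triple_mid]) (by simp) (by simp),
        hp.triple_left, pullback.condition_assoc]
  e₂_comp := by
    rw [comp_mul, divisionKite_e₂]
    refine (X.mul_congr (x' := (divisionKite X.graph hp).γ ≫ X.graph.c ≫ X.graph.e)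
      (y' := (divisionKite X.graph hp).γ) ?_ ?_ _).trans (X.one_mul _)
    · rw [Span.triple_dom, ← Category.assoc _ X.graph.c, hp.triple_comp_c]
      simp [reassoc_of% X.graph.e_c]
    · rw [← Category.assoc, Span.comp_triple]
      congr 1
      exact X.graph.span.triple_congr (by rw [← Category.assoc, Span.triple_mid]) (by simp)
        (by simp) _ _

/-- The inverse of v is p(1, v, 1), with identities at the source and target of v. Uniqueness on the
division kite makes it a right inverse; a right inverse available for every arrow is two-sided by
associativity. -/
theorem hasInverses_of_uniqueMul (h : UniqueMul M) (hX : M X.graph.toSpan) :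
    X.HasInverses := by
  obtain ⟨p, hp, -⟩ := h X.graph.span.kernelKite hX
  replace hp := (X.graph.span.kernelKite_isMul_iff p).1 hp
  let i : X.graph.C₁ ⟶ X.graph.C₁ := X.graph.span.triple (X.graph.d ≫ X.graph.e) (𝟙 _)
    (X.graph.c ≫ X.graph.e) (by simp [X.graph.e_d]) (by simp [X.graph.e_c]) ≫ p
  have hd : i ≫ X.graph.d = X.graph.c := (hp.triple_comp_d _ _ _ _ _).trans (by simp [X.graph.e_d])
  have hc : i ≫ X.graph.c = X.graph.d := (hp.triple_comp_c _ _ _ _ _).trans (by simp [X.graph.e_c])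
  have right : X.mul (𝟙 _) i (by rw [hc, Category.id_comp]) = X.graph.c ≫ X.graph.e := by
    -- Evaluating p(x,v,w) = x p(1,v,w) at (v, v, 1) gives 1 = v i(v).
    have key := (h (divisionKite X.graph hp) hX).unique (isMul_maltsev X.graph hp)
      (isMul_mul_maltsev hp)
    have := congrArg (X.graph.span.triple (𝟙 X.graph.C₁) (𝟙 _) (X.graph.c ≫ X.graph.e) rfl
      (by simp [X.graph.e_c]) ≫ ·) key
    dsimp only at this
    rw [comp_mul, hp.triple_right] at this
    rw [this]
    refine X.mul_congr (by simp) ?_ _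
    rw [← Category.assoc, Span.comp_triple]
    refine congrArg (· ≫ p) (X.graph.span.triple_congr ?_ (by simp) (by simp) _ _)
    rw [← Category.assoc _ X.graph.span.mid, Span.triple_mid, Category.id_comp]
  clear_value i
  have right_comp : X.mul i (i ≫ i) (by rw [Category.assoc, hc]) = X.graph.d ≫ X.graph.e := by
    have := congrArg (i ≫ ·) right
    rw [comp_mul, reassoc_of% hc] at this
    rw [← this]
    exact X.mul_congr (by simp) rfl _
  -- Bracketing v · i(v) · i(i(v)) in two ways gives i(i(v)) = v, which turns i(v) · i(i(v)) = 1
  -- into the left inverse law.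
  have hi : i ≫ i = 𝟙 _ := by
    have assoc := isAssociative_of_uniqueMul h hX (𝟙 _) i (i ≫ i)
      (by rw [hc, Category.id_comp]) (by rw [Category.assoc, hc])
    rw [X.mul_congr right rfl, X.mul_congr rfl right_comp] at assoc
    have e₁ := X.one_mul (i ≫ i)
    have e₂ := X.mul_one (𝟙 X.graph.C₁)
    rw [X.mul_congr (x' := X.graph.c ≫ X.graph.e) (by
      rw [Category.assoc, reassoc_of% hc, reassoc_of% hd]) rfl] at e₁
    rw [X.mul_congr rfl (Category.id_comp _)] at e₂
    exact e₁.symm.trans (assoc.trans e₂)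
  refine ⟨i, hd, hc, right, ?_⟩
  rw [← right_comp]
  exact X.mul_congr rfl hi.symm _

end UMG

end

end RelMaltsev

/-! ### The equivalences -/

theorem mainTheorem1 {C : Type u} [Category.{v} C] [RelMaltsev.HasLocalProducts C]
    (M : ObjectProperty (RelMaltsev.Span C))
    (hK : RelMaltsev.ClosedUnderKernelPairs M) (hL : RelMaltsev.ContainsLocalProducts M) :
    List.TFAE
      [RelMaltsev.IsIsoOfCategories (RelMaltsev.grpdToRG M),
       RelMaltsev.HasSection (RelMaltsev.grpdToRG M),
       RelMaltsev.IsIsoOfCategories (RelMaltsev.catToRG M),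
       RelMaltsev.HasSection (RelMaltsev.catToRG M),
       RelMaltsev.IsIsoOfCategories (RelMaltsev.umgToRG M),
       RelMaltsev.HasSection (RelMaltsev.umgToRG M),
       RelMaltsev.IsIsoOfCategories (RelMaltsev.preGrpdToSpan M),
       RelMaltsev.HasSection (RelMaltsev.preGrpdToSpan M),
       RelMaltsev.IsIsoOfCategories (RelMaltsev.mKiteToDiKite M),
       RelMaltsev.HasSection (RelMaltsev.mKiteToDiKite M),
       RelMaltsev.KiteCondition M] := by
  -- The Kite Condition is the hub: sections reach it through natural Mal'tsev operations, and it
  -- returns every isomorphism through unique multiplications.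
  have toKite : ∀ {Q : Prop}, (Q → Nonempty (RelMaltsev.NaturalMaltsev M)) → Q →
      RelMaltsev.KiteCondition M := fun h q => (h q).elim fun P => P.kiteCondition hL
  have toUnique : RelMaltsev.KiteCondition M → RelMaltsev.UniqueMul M :=
    fun h X hX => h.existsUnique_isMul hL X hX
  tfae_have 1 → 2 := RelMaltsev.IsIsoOfCategories.hasSection
  tfae_have 3 → 4 := RelMaltsev.IsIsoOfCategories.hasSection
  tfae_have 5 → 6 := RelMaltsev.IsIsoOfCategories.hasSection
  tfae_have 7 → 8 := RelMaltsev.IsIsoOfCategories.hasSection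
  tfae_have 9 → 10 := RelMaltsev.IsIsoOfCategories.hasSection
  tfae_have 2 → 4 := RelMaltsev.HasSection.of_restrict_comp_ι
  tfae_have 4 → 6 := RelMaltsev.HasSection.of_restrict_comp_ι
  tfae_have 6 → 11 := toKite (RelMaltsev.nonempty_naturalMaltsev_of_umg hK)
  tfae_have 8 → 11 := toKite RelMaltsev.nonempty_naturalMaltsev_of_preGrpd
  tfae_have 10 → 11 := toKite RelMaltsev.nonempty_naturalMaltsev_of_mKite
  tfae_have 11 → 9 := fun h => (toUnique h).mKite_bijectiveOver.isIsoOfCategories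
  tfae_have 11 → 7 := fun h => (toUnique h).preGrpd_bijectiveOver.isIsoOfCategories
  tfae_have 11 → 5 := fun h => (toUnique h).umg_bijectiveOver.isIsoOfCategories
  tfae_have 11 → 3 := fun h => ((toUnique h).umg_bijectiveOver.comp_ι _
    fun _ => RelMaltsev.UMG.isAssociative_of_uniqueMul (toUnique h)).isIsoOfCategories
  tfae_have 11 → 1 := fun h => (((toUnique h).umg_bijectiveOver.comp_ι _
    fun _ => RelMaltsev.UMG.isAssociative_of_uniqueMul (toUnique h)).comp_ι _
    fun _ => RelMaltsev.UMG.hasInverses_of_uniqueMul (toUnique h)).isIsoOfCategories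
  tfae_finish
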